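/- Conventions. A geometry is a set $X$ of points with a family of subsets (its subspaces) such that $\emptyset$, $X$ and all one-point sets are subspaces, intersections of subspaces are subspaces, the exchange axiom holds (if $S$ is a subspace, $x,y\notin S$ and $y\in S\vee x$, then $x\in S\vee y$), and closure is finitary (a point of the closure $\overline A$ of a set $A$ lies in the closure of a finite subset of $A$). The dimension of a subspace is the cardinality of a basis minus $1$; lines and planes are the subspaces of dimension $1$ and $2$; a hyperplane is a maximal proper subspace. A map of geometries is a morphism if preimages of subspaces are subspaces. A subset $X$ of a geometry is a subgeometry, its subspaces being the traces $S\cap X$ of the subspaces $S$. A geometry of dimension $\ge 2$ has enough points if every plane contains four points, no three of them collinear. For a point $x$ of a geometry $G$, the quotient $G/x$ is the set of classes $[y]$ of points $y\neq x$, where $[y]=[z]$ iff $y\vee x=z\vee x$; its subspaces are the sets $S/x=\{[y] : y\in S,\ y\neq x\}$ with $S$ a subspace through $x$. If $X\subseteq G$ is a subgeometry and $x\in X$, then $X/x=\{[y] : y\in X,\ y\ne x\}$ is a subgeometry of $G/x$. A subgeometry $Y$ of an irreducible projective space $Q$ is affino-projective if $Y\cup H=Q$ for some hyperplane $H$ of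 $Q$. For a left vector space $V$ over a division ring $K$, $\mathbb P(V)$ is the set of one-dimensional subspaces of $V$, a geometry whose subspaces are the sets $\mathbb P(W)$ with $W\subseteq V$ a vector subspace. A semilinear map $\Phi\colon V\to V'$ is an additive map with $\Phi(\lambda v)=\sigma(\lambda)\Phi(v)$ for some ring homomorphism $\sigma\colon K\to K'$ (not necessarily surjective); the partial projective morphism associated to it is the partial map $\phi\colon\mathbb P(V)\dashrightarrow\mathbb P(V')$, $\langle v\rangle\mapsto\langle\Phi(v)\rangle$, defined exactly on $\mathbb P(V)\setminus\mathbb P(\ker\Phi)$. Theorem. Let $\mathbb P=\mathbb P(V)$ and $\mathbb P'=\mathbb P(V')$ be projective spaces over division rings $K$ and $K'$, respectively, with $|K|\ge 4$ or $|K|=3=\operatorname{char}K'$. Let $X\subseteq\mathbb P$ be a subgeometry with enough points and let $\varphi\colon X\to\mathbb P'$ be a morphism of geometries such that: 1. the image of $\varphi$ is not contained in a subspace of $\mathbb P'$ of dimension at most $2$; 2. there are points $x_1,x_2\in X$ such that $\varphi(x_1)\neq\varphi(x_2)$ and, for $i=1,2$, $X/x_i$ is an affino-projective subgeometry of $\mathbb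 P/x_i$. Then $\varphi$ is the restriction to $X$ of a unique partial projective morphism $\phi\colon\mathbb P\dashrightarrow\mathbb P'$; that is, there is exactly one partial projective morphism $\phi$ that is defined at every point of $X$ and satisfies $\phi(x)=\varphi(x)$ for all $x\in X$. -/

import Mathlib

open scoped LinearAlgebra.Projectivization

/-- The closure of `A` with respect to a family of subsets (the flats): the intersection of all
flats containing `A`. -/
def flatClosure {X : Type*} (IsFlat : Set X → Prop) (A : Set X) : Set X :=
  ⋂₀ {S | IsFlat S ∧ A ⊆ S}

/-- A geometry on a set `X` of points: a family of subsets, the flats (or subspaces), satisfying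
the axioms of a finitary simple closure space with the exchange property. -/
structure Geometry (X : Type*) where
  IsFlat : Set X → Prop
  isFlat_empty : IsFlat ∅
  isFlat_univ : IsFlat Set.univ
  isFlat_singleton : ∀ x : X, IsFlat {x}
  isFlat_sInter : ∀ F : Set (Set X), (∀ S ∈ F, IsFlat S) → IsFlat (⋂₀ F)
  exchange : ∀ (S : Set X) (x y : X), IsFlat S → x ∉ S → y ∉ S →
    y ∈ flatClosure IsFlat (insert x S) → x ∈ flatClosure IsFlat (insert y S)
  finitary : ∀ (A : Set X) (x : X), x ∈ flatClosure IsFlat A →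
    ∃ B : Set X, B.Finite ∧ B ⊆ A ∧ x ∈ flatClosure IsFlat B

namespace Geometry

variable {X X' : Type*} (G : Geometry X) (G' : Geometry X')

/-- The closure of a set of points: the least flat containing it. -/
def closure (A : Set X) : Set X := flatClosure G.IsFlat A

theorem isFlat_closure (A : Set X) : G.IsFlat (G.closure A) :=
  G.isFlat_sInter _ fun _ hS => hS.1

theorem subset_closure (A : Set X) : A ⊆ G.closure A :=
  Set.subset_sInter fun _ hS => hS.2

theorem closure_subset {A S : Set X} (hS : G.IsFlat S) (h : A ⊆ S) : G.closure A ⊆ S :=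
  Set.sInter_subset_of_mem ⟨hS, h⟩

theorem closure_mono {A B : Set X} (h : A ⊆ B) : G.closure A ⊆ G.closure B :=
  G.closure_subset (G.isFlat_closure B) (h.trans (G.subset_closure B))

theorem closure_eq {S : Set X} (hS : G.IsFlat S) : G.closure S = S :=
  (G.closure_subset hS subset_rfl).antisymm (G.subset_closure S)

/-- No point of `A` lies in the closure of the other points of `A`. -/
def Independent (A : Set X) : Prop := ∀ a ∈ A, a ∉ G.closure (A \ {a})

/-- `A` is a basis of the flat `S`. -/
def IsBasis (A S : Set X) : Prop := G.Independent A ∧ G.closure A = S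

/-- `S` is a flat of (finite) dimension `r`, i.e. it has a basis of `r + 1` points. -/
def HasDim (S : Set X) (r : ℕ) : Prop := ∃ A : Set X, G.IsBasis A S ∧ A.encard = r + 1

/-- A line is a flat of dimension 1. -/
def IsLine (S : Set X) : Prop := G.HasDim S 1

/-- A plane is a flat of dimension 2. -/
def IsPlane (S : Set X) : Prop := G.HasDim S 2

/-- A hyperplane is a maximal proper flat. -/
def IsHyperplane (H : Set X) : Prop :=
  G.IsFlat H ∧ H ≠ Set.univ ∧ ∀ S, G.IsFlat S → H ⊆ S → S = H ∨ S = Set.univ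

/-- A geometry of dimension at least 2 has enough points when every plane contains four points,
no three of which are collinear. -/
def EnoughPoints : Prop :=
  (∃ A : Set X, G.IsBasis A Set.univ ∧ 3 ≤ A.encard) ∧
  ∀ P : Set X, G.IsPlane P → ∃ Q ⊆ P, Q.encard = 4 ∧
    ∀ T ⊆ Q, T.encard = 3 → ¬ ∃ L, G.IsLine L ∧ T ⊆ L

/-- A morphism of geometries: preimages of flats are flats. -/
def IsMorphism (φ : X → X') : Prop := ∀ S' : Set X', G'.IsFlat S' → G.IsFlat (φ ⁻¹' S')

/-- A set `Y` of points of an irreducible projective space `G` is affino-projective when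
together with some hyperplane it covers `G`. -/
def IsAffinoProjective (Y : Set X) : Prop := ∃ H, G.IsHyperplane H ∧ Y ∪ H = Set.univ

section Sub

variable (A : Set X)

/-- The flats of a subset `A`: the traces on `A` of the flats of the ambient geometry. -/
def SubIsFlat (T : Set A) : Prop := ∃ S : Set X, G.IsFlat S ∧ T = Subtype.val ⁻¹' S

theorem flatClosure_sub (T : Set A) :
    flatClosure (G.SubIsFlat A) T = Subtype.val ⁻¹' G.closure (Subtype.val '' T) := by
  apply Set.Subset.antisymm
  · refine Set.sInter_subset_of_mem ⟨⟨_, G.isFlat_closure _, rfl⟩, ?_⟩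
    exact Set.image_subset_iff.1 (G.subset_closure _)
  · refine Set.subset_sInter ?_
    rintro _ ⟨⟨S, hS, rfl⟩, hT⟩
    exact Set.preimage_mono (G.closure_subset hS (Set.image_subset_iff.2 hT))

/-- The subgeometry of `G` carried by a subset `A`. -/
def sub : Geometry A where
  IsFlat := G.SubIsFlat A
  isFlat_empty := ⟨∅, G.isFlat_empty, by simp⟩
  isFlat_univ := ⟨Set.univ, G.isFlat_univ, by simp⟩
  isFlat_singleton x := ⟨{x.1}, G.isFlat_singleton _, by ext y; simp [Subtype.ext_iff]⟩
  isFlat_sInter F hF := by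
    refine ⟨⋂₀ {S | G.IsFlat S ∧ Subtype.val ⁻¹' S ∈ F}, G.isFlat_sInter _ fun S hS => hS.1, ?_⟩
    ext y
    constructor
    · intro hy S hS
      exact hy _ hS.2
    · intro hy T hT
      obtain ⟨S, hS, rfl⟩ := hF T hT
      exact hy S ⟨hS, hT⟩
  exchange T x y hT hx hy h := by
    obtain ⟨S, hS, rfl⟩ := hT
    rw [flatClosure_sub, Set.image_insert_eq, Subtype.image_preimage_coe] at h ⊢
    have hSA : Subtype.val ⁻¹' G.closure (A ∩ S) = (Subtype.val ⁻¹' S : Set A) := by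
      apply Set.Subset.antisymm
      · exact Set.preimage_mono (G.closure_subset hS Set.inter_subset_right)
      · intro z hz
        exact G.subset_closure _ ⟨z.2, hz⟩
    have key : ∀ z : A, G.closure (insert z.1 (G.closure (A ∩ S))) =
        G.closure (insert z.1 (A ∩ S)) := by
      intro z
      apply Set.Subset.antisymm
      · refine G.closure_subset (G.isFlat_closure _) (Set.insert_subset ?_ ?_)
        · exact G.subset_closure _ (Set.mem_insert _ _)
        · exact G.closure_mono (Set.subset_insert _ _)
      · exact G.closure_mono (Set.insert_subset_insert (G.subset_closure _))
    have hx' : x.1 ∉ G.closure (A ∩ S) := fun hh => hx (hSA.subset hh)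
    have hy' : y.1 ∉ G.closure (A ∩ S) := fun hh => hy (hSA.subset hh)
    have := G.exchange _ x.1 y.1 (G.isFlat_closure (A ∩ S)) hx' hy'
      ((key x).symm.subset h)
    exact (key y).subset this
  finitary T x h := by
    rw [flatClosure_sub] at h
    obtain ⟨B, hB, hBT, hx⟩ := G.finitary _ _ h
    refine ⟨Subtype.val ⁻¹' B, hB.preimage Subtype.val_injective.injOn, ?_, ?_⟩
    · intro z hz
      obtain ⟨w, hw, hwz⟩ := hBT hz
      rwa [← Subtype.ext hwz]
    · rw [flatClosure_sub]
      refine G.closure_mono ?_ hx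
      intro z hz
      obtain ⟨w, hw, rfl⟩ := hBT hz
      exact ⟨w, hz, rfl⟩

end Sub

section Quotient

variable (E : Set X)

/-- Two points outside `E` are equivalent when they have the same join with `E`. -/
def quotSetoid : Setoid {x : X // x ∉ E} where
  r x y := G.closure (insert x.1 E) = G.closure (insert y.1 E)
  iseqv := ⟨fun _ => rfl, fun h => h.symm, fun h h' => h.trans h'⟩

/-- The set of points of the quotient `X / E`. -/
def Quot : Type _ := Quotient (G.quotSetoid E)

/-- The class in `X / E` of a point outside `E`. -/
def toQuot (x : {x : X // x ∉ E}) : G.Quot E := Quotient.mk (G.quotSetoid E) x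

/-- The set of classes in `X / E` of the points of `S` outside `E`. For `S` ranging over the flats
of `X` containing `E`, these are the flats of `X / E`. For an arbitrary subset `S` of `X`
containing `E`, this is the image of the (injective) natural map `S / E → X / E`, `[x] ↦ [x]`,
i.e. the subset of `X / E` carrying the subgeometry `S / E`. -/
def quotImage (S : Set X) : Set (G.Quot E) :=
  {q | ∃ x : {x : X // x ∉ E}, x.1 ∈ S ∧ G.toQuot E x = q}

/-- The flats of `X / E`. -/
def QuotIsFlat (T : Set (G.Quot E)) : Prop :=
  ∃ S : Set X, G.IsFlat S ∧ E ⊆ S ∧ T = G.quotImage E S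

/-- The union of `E` with all points whose class lies in `T`. -/
def quotPull (T : Set (G.Quot E)) : Set X := {x | ∀ h : x ∉ E, G.toQuot E ⟨x, h⟩ ∈ T}

theorem subset_quotPull (T : Set (G.Quot E)) : E ⊆ G.quotPull E T := fun _ hx h => (h hx).elim

theorem quotImage_quotPull (T : Set (G.Quot E)) : G.quotImage E (G.quotPull E T) = T := by
  ext q
  constructor
  · rintro ⟨x, hx, rfl⟩
    exact hx x.2
  · intro hq
    obtain ⟨x, rfl⟩ := Quotient.exists_rep q
    exact ⟨x, fun _ => hq, rfl⟩

theorem quotPull_quotImage {S : Set X} (hS : G.IsFlat S) (hE : E ⊆ S) :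
    G.quotPull E (G.quotImage E S) = S := by
  ext x
  constructor
  · intro hx
    by_cases h : x ∈ E
    · exact hE h
    · obtain ⟨y, hy, hyx⟩ := hx h
      have hc : G.closure (insert y.1 E) = G.closure (insert x E) := Quotient.exact hyx
      have : x ∈ G.closure (insert y.1 E) := hc ▸ G.subset_closure _ (Set.mem_insert _ _)
      exact G.closure_subset hS (Set.insert_subset hy hE) this
  · intro hx h
    exact ⟨⟨x, h⟩, hx, rfl⟩

theorem quotIsFlat_iff (T : Set (G.Quot E)) : G.QuotIsFlat E T ↔ G.IsFlat (G.quotPull E T) := by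
  constructor
  · rintro ⟨S, hS, hE, rfl⟩
    rwa [G.quotPull_quotImage E hS hE]
  · intro h
    exact ⟨_, h, G.subset_quotPull E T, (G.quotImage_quotPull E T).symm⟩

theorem quotPull_mono {T U : Set (G.Quot E)} (h : T ⊆ U) : G.quotPull E T ⊆ G.quotPull E U :=
  fun _ hx hE => h (hx hE)

theorem quotImage_mono {S U : Set X} (h : S ⊆ U) : G.quotImage E S ⊆ G.quotImage E U := by
  rintro q ⟨x, hx, rfl⟩
  exact ⟨x, h hx, rfl⟩

theorem flatClosure_quot (T : Set (G.Quot E)) :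
    flatClosure (G.QuotIsFlat E) T = G.quotImage E (G.closure (G.quotPull E T)) := by
  apply Set.Subset.antisymm
  · refine Set.sInter_subset_of_mem ⟨⟨_, G.isFlat_closure _,
      (G.subset_quotPull E T).trans (G.subset_closure _), rfl⟩, ?_⟩
    rw [← G.quotImage_quotPull E T]
    apply G.quotImage_mono
    rw [G.quotImage_quotPull E T]
    exact G.subset_closure _
  · refine Set.subset_sInter ?_
    rintro U ⟨hU, hT⟩
    rw [← G.quotImage_quotPull E U]
    exact G.quotImage_mono E
      (G.closure_subset ((G.quotIsFlat_iff E U).1 hU) (G.quotPull_mono E hT))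

theorem closure_insert_eq {S : Set X} (x y : X) (hS : G.IsFlat S) (hx : x ∉ S) (hy : y ∉ S)
    (h : y ∈ G.closure (insert x S)) : G.closure (insert y S) = G.closure (insert x S) := by
  have h' : x ∈ G.closure (insert y S) := G.exchange S x y hS hx hy h
  apply Set.Subset.antisymm
  · exact G.closure_subset (G.isFlat_closure _)
      (Set.insert_subset h ((Set.subset_insert _ _).trans (G.subset_closure _)))
  · exact G.closure_subset (G.isFlat_closure _)
      (Set.insert_subset h' ((Set.subset_insert _ _).trans (G.subset_closure _)))

theorem closure_quotPull_insert (x : {x : X // x ∉ E}) (T : Set (G.Quot E)) :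
    G.closure (G.quotPull E (insert (G.toQuot E x) T)) =
      G.closure (insert x.1 (G.quotPull E T)) := by
  apply Set.Subset.antisymm
  · refine G.closure_subset (G.isFlat_closure _) fun y hy => ?_
    by_cases h : y ∈ E
    · exact G.subset_closure _ (Or.inr (G.subset_quotPull E T h))
    · rcases hy h with hyx | hyT
      · have hc : G.closure (insert y E) = G.closure (insert x.1 E) := Quotient.exact hyx
        have hm : y ∈ G.closure (insert x.1 E) := hc ▸ G.subset_closure _ (Set.mem_insert _ _)
        exact G.closure_mono (Set.insert_subset_insert (G.subset_quotPull E T)) hm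
      · exact G.subset_closure _ (Or.inr fun _ => hyT)
  · refine G.closure_mono (Set.insert_subset (fun _ => Or.inl rfl) ?_)
    exact G.quotPull_mono E (Set.subset_insert _ _)

/-- The quotient geometry `X / E` of `X` by a flat `E`. -/
def quotient (hE : G.IsFlat E) : Geometry (G.Quot E) where
  IsFlat := G.QuotIsFlat E
  isFlat_empty := ⟨E, hE, subset_rfl, by
    ext q
    constructor
    · exact False.elim
    · rintro ⟨x, hx, -⟩
      exact x.2 hx⟩
  isFlat_univ := ⟨Set.univ, G.isFlat_univ, Set.subset_univ _, by
    ext q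
    obtain ⟨x, rfl⟩ := Quotient.exists_rep q
    exact ⟨fun _ => ⟨x, trivial, rfl⟩, fun _ => trivial⟩⟩
  isFlat_singleton q := by
    obtain ⟨x, rfl⟩ := Quotient.exists_rep q
    refine ⟨G.closure (insert x.1 E), G.isFlat_closure _,
      (Set.subset_insert _ _).trans (G.subset_closure _), ?_⟩
    ext q
    constructor
    · rintro rfl
      exact ⟨x, G.subset_closure _ (Set.mem_insert _ _), rfl⟩
    · rintro ⟨y, hy, rfl⟩
      exact Quotient.sound (G.closure_insert_eq x.1 y.1 hE x.2 y.2 hy)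
  isFlat_sInter F hF := by
    rw [quotIsFlat_iff]
    have : G.quotPull E (⋂₀ F) = ⋂₀ (G.quotPull E '' F) := by
      ext x
      constructor
      · rintro hx _ ⟨T, hT, rfl⟩ h
        exact hx h T hT
      · intro hx h T hT
        exact hx _ ⟨T, hT, rfl⟩ h
    rw [this]
    apply G.isFlat_sInter
    rintro _ ⟨T, hT, rfl⟩
    exact (G.quotIsFlat_iff E T).1 (hF T hT)
  exchange T p q hT hp hq h := by
    obtain ⟨x, rfl⟩ := Quotient.exists_rep p
    obtain ⟨y, rfl⟩ := Quotient.exists_rep q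
    have hT' := (G.quotIsFlat_iff E T).1 hT
    have hx : x.1 ∉ G.quotPull E T := fun hh => hp (hh x.2)
    have hy : y.1 ∉ G.quotPull E T := fun hh => hq (hh y.2)
    have hsub : ∀ z : {x : X // x ∉ E}, E ⊆ G.closure (insert z.1 (G.quotPull E T)) := fun z =>
      (G.subset_quotPull E T).trans ((Set.subset_insert _ _).trans (G.subset_closure _))
    change G.toQuot E y ∈ flatClosure (G.QuotIsFlat E) (insert (G.toQuot E x) T) at h
    change G.toQuot E x ∈ flatClosure (G.QuotIsFlat E) (insert (G.toQuot E y) T)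
    rw [flatClosure_quot, G.closure_quotPull_insert E] at h ⊢
    have hy' : y.1 ∈ G.closure (insert x.1 (G.quotPull E T)) := by
      rw [← G.quotPull_quotImage E (G.isFlat_closure _) (hsub x)]
      exact fun _ => h
    exact ⟨x, G.exchange _ x.1 y.1 hT' hx hy hy', rfl⟩
  finitary T q h := by
    rw [flatClosure_quot] at h
    obtain ⟨x, hx, rfl⟩ := h
    obtain ⟨B, hB, hBT, hxB⟩ := G.finitary _ _ hx
    refine ⟨G.quotImage E B, ?_, ?_, ?_⟩
    · have : G.quotImage E B = G.toQuot E '' (Subtype.val ⁻¹' B) := by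
        ext q
        rfl
      rw [this]
      exact (hB.preimage Subtype.val_injective.injOn).image _
    · rw [← G.quotImage_quotPull E T]
      exact G.quotImage_mono E hBT
    · rw [flatClosure_quot]
      refine ⟨x, G.closure_mono ?_ hxB, rfl⟩
      intro y hy h
      exact ⟨⟨y, h⟩, hy, rfl⟩

end Quotient

end Geometry

section Projective

variable (K V : Type*) [DivisionRing K] [AddCommGroup V] [Module K V]

/-- The flats of `ℙ K V`: the projectivizations of the vector subspaces of `V`. -/
def ProjIsFlat (S : Set (ℙ K V)) : Prop :=
  ∃ W : Submodule K V, S = {p | p.submodule ≤ W}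

variable {K V}

theorem proj_submodule_le_iff (p : ℙ K V) (W : Submodule K V) : p.submodule ≤ W ↔ p.rep ∈ W := by
  rw [Projectivization.submodule_eq, Submodule.span_singleton_le_iff_mem]

theorem flatClosure_proj (A : Set (ℙ K V)) :
    flatClosure (ProjIsFlat K V) A =
      {p | p.rep ∈ Submodule.span K (Projectivization.rep '' A)} := by
  apply Set.Subset.antisymm
  · refine Set.sInter_subset_of_mem
      ⟨⟨Submodule.span K (Projectivization.rep '' A), ?_⟩, ?_⟩
    · ext p
      exact (proj_submodule_le_iff p (Submodule.span K (Projectivization.rep '' A))).symm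
    · intro p hp
      exact Submodule.subset_span ⟨p, hp, rfl⟩
  · refine Set.subset_sInter ?_
    rintro _ ⟨⟨W, rfl⟩, hA⟩ p hp
    refine (proj_submodule_le_iff p W).2 (Submodule.span_le.2 ?_ hp)
    rintro _ ⟨a, ha, rfl⟩
    exact (proj_submodule_le_iff a W).1 (hA ha)

variable (K V)

/-- The projective space of a vector space `V` over a division ring `K`, as a geometry. -/
def projGeometry : Geometry (ℙ K V) where
  IsFlat := ProjIsFlat K V
  isFlat_empty := ⟨⊥, by
    ext p
    refine ⟨False.elim, fun h => p.rep_nonzero ?_⟩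
    exact (Submodule.mem_bot K).1 ((proj_submodule_le_iff p ⊥).1 h)⟩
  isFlat_univ := ⟨⊤, by simp⟩
  isFlat_singleton p := ⟨p.submodule, by
    ext q
    constructor
    · rintro rfl
      exact le_refl q.submodule
    · intro h
      replace h := (proj_submodule_le_iff q p.submodule).1 h
      rw [Projectivization.submodule_eq, Submodule.mem_span_singleton] at h
      obtain ⟨a, ha⟩ := h
      change q = p
      rw [← q.mk_rep, ← p.mk_rep, Projectivization.mk_eq_mk_iff']
      exact ⟨a, ha⟩⟩
  isFlat_sInter F hF := by
    refine ⟨sInf {W | {p : ℙ K V | p.submodule ≤ W} ∈ F}, ?_⟩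
    ext p
    constructor
    · intro hp
      refine (le_sInf fun W hW => ?_ : p.submodule ≤ _)
      exact hp {q | q.submodule ≤ W} hW
    · intro hp S hS
      obtain ⟨W, rfl⟩ := hF S hS
      exact le_trans (show p.submodule ≤ _ from hp) (sInf_le hS)
  exchange S x y hS hx hy h := by
    obtain ⟨W, rfl⟩ := hS
    rw [flatClosure_proj, Set.image_insert_eq] at h ⊢
    refine (mem_span_insert_exchange h fun hh => hy ?_)
    refine (proj_submodule_le_iff y W).2 (Submodule.span_le.2 ?_ hh)
    rintro _ ⟨a, ha, rfl⟩
    exact (proj_submodule_le_iff a W).1 ha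
  finitary A x h := by
    rw [flatClosure_proj] at h
    obtain ⟨T, hT, hx⟩ := Submodule.mem_span_finite_of_mem_span h
    obtain ⟨B, hBA, hBT⟩ := Set.subset_image_iff.1 hT
    refine ⟨B, ?_, hBA, ?_⟩
    · refine Set.Finite.of_finite_image (f := Projectivization.rep) ?_ ?_
      · rw [hBT]
        exact T.finite_toSet
      · intro p _ q _ hpq
        rw [← p.mk_rep, ← q.mk_rep, Projectivization.mk_eq_mk_iff']
        exact ⟨1, by rw [one_smul]; exact hpq.symm⟩
    · rw [flatClosure_proj, hBT]
      exact hx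

variable {K V}
variable {K' V' : Type*} [DivisionRing K'] [AddCommGroup V'] [Module K' V']

/-- The partial map `⟨v⟩ ↦ ⟨Φ v⟩` induced by a semilinear map `Φ`; it is defined at `⟨v⟩` exactly
when `Φ v ≠ 0`. -/
noncomputable def partialProj {σ : K →+* K'} (Φ : V →ₛₗ[σ] V') : ℙ K V →. ℙ K' V' :=
  fun p => ⟨Φ p.rep ≠ 0, fun h => Projectivization.mk K' (Φ p.rep) h⟩

theorem mem_partialProj_mk {σ : K →+* K'} (Φ : V →ₛₗ[σ] V') (v : V) (hv : v ≠ 0) (q : ℙ K' V') :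
    q ∈ partialProj Φ (Projectivization.mk K v hv) ↔
      ∃ h : Φ v ≠ 0, Projectivization.mk K' (Φ v) h = q := by
  obtain ⟨a, ha⟩ := Projectivization.exists_smul_eq_mk_rep K v hv
  have hrep : Φ (Projectivization.mk K v hv).rep = σ a • Φ v := by
    rw [← ha, Units.smul_def, LinearMap.map_smulₛₗ]
  have hσ : σ (a : K) ≠ 0 := (map_ne_zero σ).2 a.ne_zero
  have hiff : Φ (Projectivization.mk K v hv).rep ≠ 0 ↔ Φ v ≠ 0 := by
    rw [hrep, smul_ne_zero_iff]
    exact and_iff_right hσ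
  have heq : ∀ h h', Projectivization.mk K' (Φ (Projectivization.mk K v hv).rep) h =
      Projectivization.mk K' (Φ v) h' := fun h h' =>
    (Projectivization.mk_eq_mk_iff' K' _ _ h h').2 ⟨σ a, hrep.symm⟩
  constructor
  · rintro ⟨h, rfl⟩
    exact ⟨hiff.1 h, (heq h (hiff.1 h)).symm⟩
  · rintro ⟨h, rfl⟩
    exact ⟨hiff.2 h, heq (hiff.2 h) h⟩

/-- A partial projective morphism is a partial map induced by a semilinear map (with respect to
an arbitrary ring morphism `K →+* K'`). -/
def IsPartialProjectiveMorphism (f : ℙ K V →. ℙ K' V') : Prop :=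
  ∃ (σ : K →+* K') (Φ : V →ₛₗ[σ] V'), f = partialProj Φ

end Projective

/- Project from `φ x₁` and from `φ x₂`. As `X / xᵢ` contains the complement of a hyperplane, the
projected map amounts to a morphism of an affine space. It sends parallel lines to lines through a
common point, by Desargues' theorem if `K` has at least four elements and by the uniqueness of the
Hesse configuration in characteristic three, so it extends to the hyperplane at infinity and, by the
fundamental theorem of projective geometry, is induced by a semilinear map `Φᵢ` into `V' / φ xᵢ`.
Over `V' / (φ x₁ ⊔ φ x₂)` the maps `Φ₁` and `Φ₂` are proportional, so after rescaling they glue to a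
semilinear map into `V'`, the fibre product of the two quotients. It induces `φ` at the points not
sent to the line `φ x₁ ⊔ φ x₂`; a point sent to this line is generated by points of the former kind,
since `X` has enough points. -/

open Submodule

section LinearAlgebra

variable {K V : Type*} [DivisionRing K] [AddCommGroup V] [Module K V] {N : Submodule K V}
  {u v w x y z : V}

theorem mem_of_mem_span_singleton (h : u ∈ span K {x}) (hx : x ∈ N) : u ∈ N :=
  span_le.2 (Set.singleton_subset_iff.2 hx) h

theorem mem_of_mem_span_pair (h : u ∈ span K {x, y}) (hx : x ∈ N) (hy : y ∈ N) : u ∈ N :=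
  span_le.2 (Set.insert_subset hx (Set.singleton_subset_iff.2 hy)) h

theorem mem_of_mem_span_triple (h : u ∈ span K {x, y, z}) (hx : x ∈ N) (hy : y ∈ N)
    (hz : z ∈ N) : u ∈ N :=
  span_le.2 (Set.insert_subset hx (Set.insert_subset hy (Set.singleton_subset_iff.2 hz))) h

theorem left_mem_span_pair (x y : V) : x ∈ span K {x, y} := mem_span_of_mem (by simp)

theorem right_mem_span_pair (x y : V) : y ∈ span K {x, y} := mem_span_of_mem (by simp)

theorem smul_mem_span_singleton (a : K) (x : V) : a • x ∈ span K {x} :=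
  smul_mem _ a (mem_span_singleton_self x)

theorem smul_add_smul_mem_span_pair (a b : K) (x y : V) : a • x + b • y ∈ span K {x, y} :=
  mem_span_pair.2 ⟨a, b, rfl⟩

theorem mem_span_singleton_symm (h : x ∈ span K {y}) (hx : x ≠ 0) : y ∈ span K {x} := by
  obtain ⟨a, rfl⟩ := mem_span_singleton.1 h
  have ha : a ≠ 0 := by rintro rfl; simp at hx
  exact (smul_mem_iff _ ha).1 (mem_span_singleton_self _)

theorem span_singleton_eq_of_mem (h : x ∈ span K {y}) (hx : x ≠ 0) : span K {x} = span K {y} :=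
  le_antisymm (by simpa using h) (by simpa using mem_span_singleton_symm h hx)

theorem span_singleton_eq_iff : span K {x} = span K {y} ↔ x ∈ span K {y} ∧ y ∈ span K {x} := by
  rw [le_antisymm_iff, span_singleton_le_iff_mem, span_singleton_le_iff_mem]

theorem mem_iff_of_span_eq (h : span K {x} = span K {y}) : x ∈ N ↔ y ∈ N := by
  rw [← span_singleton_le_iff_mem, h, span_singleton_le_iff_mem]

theorem notMem_span_left (h : x ∉ span K {y, z}) : x ∉ span K {y} :=
  fun hx => h (mem_of_mem_span_singleton hx (left_mem_span_pair y z))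

theorem notMem_span_right (h : x ∉ span K {y, z}) : x ∉ span K {z} :=
  fun hx => h (mem_of_mem_span_singleton hx (right_mem_span_pair y z))

theorem span_pair_congr (hx : span K {x} = span K {u}) (hy : span K {y} = span K {v}) :
    span K {x, y} = span K {u, v} := by
  rw [span_insert, span_insert, hx, hy]

theorem mem_span_pair_exchange (h : x ∈ span K {y, z}) (hx : x ∉ span K {z}) :
    y ∈ span K {x, z} :=
  mem_span_insert_exchange h hx

theorem mem_span_pair_exchange' (h : x ∈ span K {z, y}) (hx : x ∉ span K {z}) :
    y ∈ span K {z, x} := by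
  rw [Set.pair_comm] at h ⊢
  exact mem_span_insert_exchange h hx

theorem linearIndependent_pair_iff_notMem :
    LinearIndependent K ![x, y] ↔ x ≠ 0 ∧ y ∉ span K {x} := by
  have : (![x, y] : Fin 2 → V) = Fin.snoc ![x] y := by ext i; fin_cases i <;> rfl
  rw [this, linearIndependent_finSnoc, linearIndependent_unique_iff]
  simp

theorem linearIndependent_triple_iff_notMem :
    LinearIndependent K ![x, y, z] ↔ x ≠ 0 ∧ y ∉ span K {x} ∧ z ∉ span K {x, y} := by
  have : (![x, y, z] : Fin 3 → V) = Fin.snoc ![x, y] z := by ext i; fin_cases i <;> rfl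
  rw [this, linearIndependent_finSnoc, linearIndependent_pair_iff_notMem]
  simp [and_assoc, Set.pair_comm]

theorem linearIndependent_triple_congr (hx : span K {x} = span K {u})
    (hy : span K {y} = span K {v}) (hz : span K {z} = span K {w}) :
    LinearIndependent K ![x, y, z] ↔ LinearIndependent K ![u, v, w] := by
  have h0 : x = 0 ↔ u = 0 := by
    rw [← span_singleton_eq_bot (R := K), hx, span_singleton_eq_bot]
  rw [linearIndependent_triple_iff_notMem, linearIndependent_triple_iff_notMem,
    span_pair_congr hx hy, hx, mem_iff_of_span_eq hy, mem_iff_of_span_eq hz, ne_eq, h0]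

theorem eq_of_linearIndependent_triple (hi : LinearIndependent K ![x, y, z])
    {a b c a' b' c' : K} (h : a • x + b • y + c • z = a' • x + b' • y + c' • z) :
    a = a' ∧ b = b' ∧ c = c' := by
  have := Fintype.linearIndependent_iff.1 hi ![a - a', b - b', c - c'] (by
    simp only [Fin.sum_univ_three, Matrix.cons_val, sub_smul]
    rw [← sub_eq_zero.2 h]
    abel)
  exact ⟨sub_eq_zero.1 (this 0), sub_eq_zero.1 (this 1), sub_eq_zero.1 (this 2)⟩

theorem span_range_eq_of_linearIndependent {ι : Type*} [Finite ι] {v w : ι → V}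
    (hv : LinearIndependent K v) (h : ∀ i, v i ∈ span K (Set.range w)) :
    span K (Set.range v) = span K (Set.range w) := by
  have := Fintype.ofFinite ι
  have : FiniteDimensional K (span K (Set.range w)) := .span_of_finite K (Set.finite_range w)
  refine eq_of_le_of_finrank_le (span_le.2 (Set.range_subset_iff.2 h)) ?_
  rw [finrank_span_eq_card hv]
  exact finrank_range_le_card w

theorem range_triple {α : Type*} (x y z : α) : Set.range ![x, y, z] = {x, y, z} := by
  simp only [Matrix.range_cons, Matrix.range_empty, Set.union_empty, Set.singleton_union]

theorem span_pair_eq_of_mem (hx : x ∈ span K {u, v}) (hy : y ∈ span K {u, v})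
    (hx0 : x ≠ 0) (hxy : y ∉ span K {x}) : span K {x, y} = span K {u, v} := by
  rw [← Matrix.range_cons_cons_empty u v ![]] at hx hy ⊢
  rw [← Matrix.range_cons_cons_empty x y ![]]
  exact span_range_eq_of_linearIndependent (linearIndependent_pair_iff_notMem.2 ⟨hx0, hxy⟩)
    (Fin.forall_fin_two.2 ⟨hx, hy⟩)

end LinearAlgebra

section Proportional

variable {V L W : Type*} [AddCommGroup V] [DivisionRing L] [AddCommGroup W] [Module L W]

theorem exists_smul_of_add_mem_span {p q p' q' : W} (hi : LinearIndependent L ![p, q])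
    (hp : p' ∈ span L {p}) (hq : q' ∈ span L {q}) (h : p' + q' ∈ span L {p + q}) :
    ∃ c : L, p' = c • p ∧ q' = c • q := by
  obtain ⟨a, rfl⟩ := mem_span_singleton.1 hp
  obtain ⟨b, rfl⟩ := mem_span_singleton.1 hq
  obtain ⟨c, hc⟩ := mem_span_singleton.1 h
  obtain ⟨rfl, rfl⟩ := hi.eq_of_pair (hc.symm.trans (smul_add c p q))
  exact ⟨_, rfl, rfl⟩

theorem exists_eq_smul_of_mem_span (Φ T : V →+ W) (hr : ∀ y : W, ∃ x, Φ x ∉ span L {y})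
    (hT : ∀ x, T x ∈ span L {Φ x}) : ∃ c : L, ∀ x, T x = c • Φ x := by
  obtain ⟨o, ho⟩ := hr 0
  have ho0 : Φ o ≠ 0 := by simpa using ho
  obtain ⟨c, hc⟩ := mem_span_singleton.1 (hT o)
  have hoff : ∀ x, Φ x ∉ span L {Φ o} → T x = c • Φ x := fun x hx => by
    obtain ⟨d, hdo, hdx⟩ := exists_smul_of_add_mem_span
      (linearIndependent_pair_iff_notMem.2 ⟨ho0, hx⟩) (hT o) (hT x)
      (by simpa only [map_add] using hT (o + x))
    rwa [smul_left_injective L ho0 (hc.trans hdo)]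
  refine ⟨c, fun x => ?_⟩
  by_cases hx : Φ x ∈ span L {Φ o}
  · obtain ⟨z, hz⟩ := hr (Φ o)
    have hxz := hoff (x + z) (by rwa [map_add, add_mem_cancel_left hx])
    rwa [map_add, map_add, smul_add, hoff z hz, add_left_inj] at hxz
  · exact hoff x hx

variable {K : Type*} [DivisionRing K] [Module K V]

theorem exists_semilinear_of_smul_mem_span (Φ : V →+ W) (hr : ∀ y : W, ∃ x, Φ x ∉ span L {y})
    (h : ∀ (k : K) x, Φ (k • x) ∈ span L {Φ x}) :
    ∃ (σ : K →+* L) (Ψ : V →ₛₗ[σ] W), ∀ x, Ψ x = Φ x := by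
  choose c hc using fun k : K => exists_eq_smul_of_mem_span Φ
    (Φ.comp (DistribSMul.toAddMonoidHom V k)) hr (h k)
  replace hc : ∀ k x, Φ (k • x) = c k • Φ x := hc
  obtain ⟨o, ho⟩ := hr 0
  have inj : Function.Injective fun a : L => a • Φ o :=
    smul_left_injective L (by simpa using ho)
  refine ⟨
    { toFun := c
      map_one' := inj (by simp [← hc])
      map_mul' := fun a b => inj (by simp only [← hc, mul_smul])
      map_zero' := inj (by simp [← hc])
      map_add' := fun a b => inj (by simp only [← hc, add_smul, map_add]) },
    { toFun := Φ, map_add' := map_add Φ, map_smul' := hc }, fun _ => rfl⟩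

end Proportional

section FundamentalTheorem

variable {K V L W : Type*} [DivisionRing K] [AddCommGroup V] [Module K V]
  [DivisionRing L] [AddCommGroup W] [Module L W]

section Vectors

variable {e p q u v w y : W}

theorem mem_span_add_add (hi : LinearIndependent L ![e, p, q]) (h : w ∈ span L {e + p, q})
    (h' : w ∈ span L {e + q, p}) : w ∈ span L {e + p + q} := by
  obtain ⟨a, b, rfl⟩ := mem_span_pair.1 h
  obtain ⟨c, d, h2⟩ := mem_span_pair.1 h'
  obtain ⟨rfl, rfl, rfl⟩ := eq_of_linearIndependent_triple hi
    (a := c) (b := d) (c := c) (a' := a) (b' := a) (c' := b) (by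
      simp only [smul_add] at h2; rw [← h2]; abel)
  rw [← smul_add]
  exact smul_mem_span_singleton _ _

theorem mem_span_add_of_mem (hi : LinearIndependent L ![e, p, q]) (h : w ∈ span L {p, q})
    (h' : w ∈ span L {e, e + p + q}) : w ∈ span L {p + q} := by
  obtain ⟨a, b, rfl⟩ := mem_span_pair.1 h
  obtain ⟨c, d, h2⟩ := mem_span_pair.1 h'
  obtain ⟨-, rfl, rfl⟩ := eq_of_linearIndependent_triple hi
    (a := c + d) (b := d) (c := d) (a' := 0) (b' := a) (c' := b) (by
      rw [zero_smul, zero_add, ← h2, add_smul]; simp only [smul_add]; abel)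
  rw [← smul_add]
  exact smul_mem_span_singleton _ _

theorem eq_of_add_mem_span_singleton (he : e ∉ span L {y}) (hu : u ∈ span L {y})
    (hv : v ∈ span L {y}) (hu' : e + u ∈ span L {w}) (hv' : e + v ∈ span L {w}) : u = v := by
  obtain ⟨s, hs⟩ := mem_span_singleton.1 hu'
  obtain ⟨t, ht⟩ := mem_span_singleton.1 hv'
  have h : (s - t) • w = u - v := by rw [sub_smul, hs, ht]; abel
  by_contra huv
  have hst : s - t ≠ 0 := fun h0 => huv (sub_eq_zero.1 (by rw [← h, h0, zero_smul]))
  have hw : w ∈ span L {y} := (smul_mem_iff _ hst).1 (h ▸ sub_mem hu hv)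
  exact he ((add_mem_cancel_right hu).1 (mem_of_mem_span_singleton hu' hw))

end Vectors

variable (K L) in
/-- A map of vector spaces representing a partial morphism of projective spaces, which is undefined
where the map vanishes. -/
structure ProjectiveMorphism (g : V → W) : Prop where
  add_mem : ∀ x y, g (x + y) ∈ span L {g x, g y}
  smul_mem : ∀ (k : K) x, g (k • x) ∈ span L {g x}

variable (L) in
/-- `v` is the multiple of `g x` normalised with respect to `g o`. -/
def IsLift (g : V → W) (o x : V) (v : W) : Prop :=
  span L {v} = span L {g x} ∧ span L {g o + v} = span L {g (o + x)}

variable (L) in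
/-- Adding `x` to the argument translates the lifts of the points off `⟨g o, g x⟩` by `v`. For `x`
with `g x ∈ ⟨g o⟩`, which have no lift of their own, this determines the value at `x` of a
semilinear map inducing `g`. -/
def IsShift (g : V → W) (o x : V) (v : W) : Prop :=
  ∀ z w, g z ∉ span L {g o, g x} → IsLift L g o z w → IsLift L g o (z + x) (w + v)

namespace ProjectiveMorphism

variable {g : V → W} (hg : ProjectiveMorphism K L g) {o x y z : V} {u v w : W}
include hg

theorem mem_span_add_left (x y : V) : g x ∈ span L {g (x + y), g y} := by
  have h := hg.add_mem (x + y) ((-1 : K) • y)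
  rw [neg_one_smul, add_neg_cancel_right] at h
  refine mem_of_mem_span_pair h (left_mem_span_pair _ _) ?_
  have hy := hg.smul_mem (-1) y
  rw [neg_one_smul] at hy
  exact mem_of_mem_span_singleton hy (right_mem_span_pair _ _)

theorem mem_span_add_right (x y : V) : g y ∈ span L {g (x + y), g x} := by
  rw [add_comm]
  exact hg.mem_span_add_left y x

theorem add_notMem {N : Submodule L W} (hz : g z ∉ N) (hx : g x ∈ N) : g (z + x) ∉ N :=
  fun h => hz (mem_of_mem_span_pair (hg.mem_span_add_left z x) h hx)

theorem isLift_of_mem (ho : g o ≠ 0) (hx : g x ∉ span L {g o}) (hv : v ∈ span L {g x})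
    (hov : g o + v ∈ span L {g (o + x)}) : IsLift L g o x v := by
  refine ⟨span_singleton_eq_of_mem hv ?_, span_singleton_eq_of_mem hov ?_⟩
  · rintro rfl
    have h := mem_span_singleton_symm (by simpa using hov) ho
    exact hx (mem_of_mem_span_pair (hg.mem_span_add_right o x) h (mem_span_singleton_self _))
  · intro h
    have hox : g o ∈ span L {g x} := by simpa [eq_neg_of_add_eq_zero_left h] using hv
    exact hx (mem_span_singleton_symm hox ho)

theorem exists_isLift (ho : g o ≠ 0) (hx : g x ∉ span L {g o}) : ∃ v, IsLift L g o x v := by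
  obtain ⟨a, b, hab⟩ := mem_span_pair.1 (hg.add_mem o x)
  have ha : a ≠ 0 := by
    rintro rfl
    rw [zero_smul, zero_add] at hab
    have hxo : g o ∈ span L {g x} := mem_of_mem_span_pair (hg.mem_span_add_left o x)
      (hab ▸ smul_mem_span_singleton _ _) (mem_span_singleton_self _)
    exact hx (mem_span_singleton_symm hxo ho)
  refine ⟨(a⁻¹ * b) • g x, hg.isLift_of_mem ho hx (smul_mem_span_singleton _ _)
    (mem_span_singleton.2 ⟨a⁻¹, ?_⟩)⟩
  rw [← hab, smul_add, smul_smul, smul_smul, inv_mul_cancel₀ ha, one_smul]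

omit hg in
theorem isLift_unique (ho : g o ≠ 0) (hx : g x ∉ span L {g o}) (hv : IsLift L g o x v)
    (hw : IsLift L g o x w) : v = w := by
  obtain ⟨hv, hov⟩ := hv
  obtain ⟨hw, how⟩ := hw
  refine eq_of_add_mem_span_singleton (fun h => hx (mem_span_singleton_symm h ho))
    (span_singleton_eq_iff.1 hv).1 (span_singleton_eq_iff.1 hw).1
    (span_singleton_eq_iff.1 hov).1 (span_singleton_eq_iff.1 how).1

theorem isLift_add (hi : LinearIndependent L ![g o, g x, g y]) (hv : IsLift L g o x v)
    (hw : IsLift L g o y w) : IsLift L g o (x + y) (v + w) := by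
  obtain ⟨ho, -, hy⟩ := linearIndependent_triple_iff_notMem.1 hi
  have hi' : LinearIndependent L ![g o, v, w] :=
    (linearIndependent_triple_congr rfl hv.1 hw.1).2 hi
  have hoxy : g (o + (x + y)) ∈ span L {g o + v + w} := by
    apply mem_span_add_add hi'
    · rw [span_pair_congr hv.2 hw.1, ← add_assoc]
      exact hg.add_mem (o + x) y
    · rw [span_pair_congr hw.2 hv.1, add_comm x, ← add_assoc]
      exact hg.add_mem (o + y) x
  have hxy : g (x + y) ∈ span L {v + w} :=
    mem_span_add_of_mem hi' (span_pair_congr hv.1 hw.1 ▸ hg.add_mem x y) <|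
      mem_of_mem_span_pair (hg.mem_span_add_right o (x + y))
        (mem_of_mem_span_singleton hoxy (right_mem_span_pair _ _)) (left_mem_span_pair _ _)
  have hxyo : g (x + y) ∉ span L {g o} := fun h => hy <|
    mem_of_mem_span_pair (hg.mem_span_add_right x y)
      (mem_of_mem_span_singleton h (left_mem_span_pair _ _)) (right_mem_span_pair _ _)
  have hxy0 : g (x + y) ≠ 0 := fun h => hxyo (h ▸ zero_mem _)
  have hoxy0 : g (o + (x + y)) ≠ 0 := fun h => hxyo <|
    mem_of_mem_span_pair (hg.mem_span_add_right o (x + y)) (h ▸ zero_mem _)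
      (mem_span_singleton_self _)
  refine hg.isLift_of_mem ho hxyo (mem_span_singleton_symm hxy hxy0) ?_
  rw [← add_assoc (g o)]
  exact mem_span_singleton_symm hoxy hoxy0

theorem isLift_add_of_isLift {z' : V} {w' : W} (ho : g o ≠ 0) (hx : g x ∈ span L {g o})
    (hz : g z ∉ span L {g o}) (hz' : g z' ∉ span L {g o, g z}) (hw : IsLift L g o z w)
    (hv : IsLift L g o (z + x) (w + v)) (hw' : IsLift L g o z' w') :
    IsLift L g o (z' + x) (w' + v) := by
  have hxz : g x ∈ span L {g o, g z} := mem_of_mem_span_singleton hx (left_mem_span_pair _ _)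
  have hi : LinearIndependent L ![g o, g z, g (z' + x)] :=
    linearIndependent_triple_iff_notMem.2 ⟨ho, hz, hg.add_notMem hz' hxz⟩
  have hi' : LinearIndependent L ![g o, g (z + x), g z'] := by
    refine linearIndependent_triple_iff_notMem.2 ⟨ho, hg.add_notMem hz hx, fun h => hz' ?_⟩
    exact mem_of_mem_span_pair h (left_mem_span_pair _ _) <|
      mem_of_mem_span_pair (hg.add_mem z x) (right_mem_span_pair _ _) hxz
  have hz'x := (linearIndependent_triple_iff_notMem.1 hi).2.2
  obtain ⟨t, ht⟩ := hg.exists_isLift ho (notMem_span_left hz'x)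
  have hsum := hg.isLift_add hi' hv hw'
  rw [add_right_comm, add_assoc] at hsum
  have hsum_notMem : g (z + (z' + x)) ∉ span L {g o} := fun h => hz'x <|
    mem_of_mem_span_pair (hg.mem_span_add_right z (z' + x))
      (mem_of_mem_span_singleton h (left_mem_span_pair _ _)) (right_mem_span_pair _ _)
  have heq := isLift_unique ho hsum_notMem (hg.isLift_add hi hw ht) hsum
  rw [add_assoc, add_right_inj, add_comm v] at heq
  exact heq ▸ ht

theorem isShift_of_isLift (ho : g o ≠ 0) (hx : g x ∉ span L {g o}) (hv : IsLift L g o x v) :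
    IsShift L g o x v := fun z w hz hw => by
  rw [add_comm z, add_comm w]
  exact hg.isLift_add (linearIndependent_triple_iff_notMem.2 ⟨ho, hx, hz⟩) hv hw

theorem isShift_mem (ho : g o ≠ 0) (hv : IsShift L g o x v) (hz : g z ∉ span L {g o, g x}) :
    v ∈ span L {g z, g x} := by
  obtain ⟨w, hw⟩ := hg.exists_isLift ho (notMem_span_left hz)
  have hwz : w ∈ span L {g z, g x} :=
    mem_of_mem_span_singleton (span_singleton_eq_iff.1 hw.1).1 (left_mem_span_pair _ _)
  refine (add_mem_cancel_left hwz).1 ?_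
  exact mem_of_mem_span_singleton (span_singleton_eq_iff.1 (hv z w hz hw).1).1 (hg.add_mem z x)

theorem eq_add_of_isShift_of_notMem {N : Submodule L W} (ho : g o ≠ 0) (hv : IsShift L g o x v)
    (hw : IsShift L g o y w) (hu : IsShift L g o (x + y) u) (hoN : g o ∈ N) (hxN : g x ∈ N)
    (hyN : g y ∈ N) (hz : g z ∉ N) : u = v + w := by
  have hzx := hg.add_notMem hz hxN
  have hzxy := hg.add_notMem hzx hyN
  obtain ⟨t, ht⟩ := hg.exists_isLift ho fun h => hz (mem_of_mem_span_singleton h hoN)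
  have hxt := hv z t (fun h => hz (mem_of_mem_span_pair h hoN hxN)) ht
  have hyt := hw (z + x) (t + v) (fun h => hzx (mem_of_mem_span_pair h hoN hyN)) hxt
  have hut := hu z t (fun h => hz (mem_of_mem_span_pair h hoN
    (mem_of_mem_span_pair (hg.add_mem x y) hxN hyN))) ht
  rw [add_assoc, add_assoc] at hyt
  refine add_left_cancel (isLift_unique ho (fun h => hzxy ?_) hut hyt)
  rw [add_assoc]
  exact mem_of_mem_span_singleton h hoN

variable (hr : ∀ y z : W, ∃ x, g x ∉ span L {y, z})
include hr

theorem exists_isShift_of_mem (ho : g o ≠ 0) (hx : g x ∈ span L {g o}) :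
    ∃ v, IsShift L g o x v := by
  obtain ⟨z, hz⟩ := hr (g o) (g o)
  rw [Set.pair_eq_singleton] at hz
  obtain ⟨w, hw⟩ := hg.exists_isLift ho hz
  obtain ⟨t, ht⟩ := hg.exists_isLift ho (hg.add_notMem hz hx)
  rw [← add_sub_cancel w t] at ht
  refine ⟨t - w, fun z' w' hz' hw' => ?_⟩
  have hz'o : g z' ∉ span L {g o} := notMem_span_left hz'
  by_cases hz'z : g z' ∈ span L {g o, g z}
  · obtain ⟨y, hy⟩ := hr (g o) (g z)
    have hyo : g y ∉ span L {g o} := notMem_span_left hy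
    have hz'y : g z' ∉ span L {g o, g y} := fun h => hy <|
      mem_of_mem_span_pair (mem_span_pair_exchange' h hz'o) (left_mem_span_pair _ _) hz'z
    obtain ⟨u, hu⟩ := hg.exists_isLift ho hyo
    exact hg.isLift_add_of_isLift ho hx hyo hz'y hu (hg.isLift_add_of_isLift ho hx hz hy hw ht hu)
      hw'
  · exact hg.isLift_add_of_isLift ho hx hz hz'z hw ht hw'

theorem isShift_unique (ho : g o ≠ 0) (hv : IsShift L g o x v) (hw : IsShift L g o x w) :
    v = w := by
  obtain ⟨z, hz⟩ := hr (g o) (g x)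
  have hzx := hg.add_notMem hz (right_mem_span_pair _ _)
  obtain ⟨t, ht⟩ := hg.exists_isLift ho (notMem_span_left hz)
  exact add_left_cancel (isLift_unique ho (notMem_span_left hzx) (hv z t hz ht) (hw z t hz ht))

theorem isLift_of_isShift (ho : g o ≠ 0) (hx : g x ∉ span L {g o}) (hv : IsShift L g o x v) :
    IsLift L g o x v := by
  obtain ⟨w, hw⟩ := hg.exists_isLift ho hx
  rwa [hg.isShift_unique hr ho hv (hg.isShift_of_isLift ho hx hw)]

theorem span_isShift_eq (ho : g o ≠ 0) (hv : IsShift L g o x v) : span L {v} = span L {g x} := by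
  by_cases hx : g x ∈ span L {g o}
  swap
  · exact (hg.isLift_of_isShift hr ho hx hv).1
  obtain ⟨z, hz⟩ := hr (g o) (g x)
  obtain ⟨y, hy⟩ := hr (g o) (g z)
  have hyx : g y ∉ span L {g o, g x} := fun h => notMem_span_left hy <|
    mem_of_mem_span_pair h (mem_span_singleton_self _) hx
  have hzx : g z ∉ span L {g x} := notMem_span_right hz
  have hvz := hg.isShift_mem ho hv hz
  have hvy := hg.isShift_mem ho hv hyx
  have hvx : v ∈ span L {g x} := by
    by_contra hvx
    have hzy : g z ∈ span L {g y, g x} := mem_of_mem_span_pair (mem_span_pair_exchange hvz hvx) hvy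
      (right_mem_span_pair _ _)
    exact hy (mem_of_mem_span_pair (mem_span_pair_exchange hzy hzx) (right_mem_span_pair _ _)
      (mem_of_mem_span_singleton hx (left_mem_span_pair _ _)))
  refine span_singleton_eq_iff.2 ⟨hvx, ?_⟩
  by_cases hv0 : v = 0
  · subst hv0
    obtain ⟨w, hw⟩ := hg.exists_isLift ho (notMem_span_left hz)
    have hwx := (hv z w hz hw).1
    rw [add_zero, hw.1] at hwx
    have hxz := mem_of_mem_span_pair (hg.mem_span_add_right z x)
      (hwx ▸ mem_span_singleton_self _) (mem_span_singleton_self _)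
    by_contra hx0
    exact hzx (mem_span_singleton_symm hxz (by simpa using hx0))
  · exact mem_span_singleton_symm hvx hv0

theorem eq_add_of_isShift (ho : g o ≠ 0) (hv : IsShift L g o x v) (hw : IsShift L g o y w)
    (hu : IsShift L g o (x + y) u) : u = v + w := by
  by_cases hy : g y ∈ span L {g o, g x}
  · obtain ⟨z, hz⟩ := hr (g o) (g x)
    exact hg.eq_add_of_isShift_of_notMem ho hv hw hu (left_mem_span_pair _ _)
      (right_mem_span_pair _ _) hy hz
  by_cases hx : g x ∈ span L {g o, g y}
  · obtain ⟨z, hz⟩ := hr (g o) (g y)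
    exact hg.eq_add_of_isShift_of_notMem ho hv hw hu (left_mem_span_pair _ _) hx
      (right_mem_span_pair _ _) hz
  replace hx : g x ∉ span L {g o} := notMem_span_left hx
  have hyo : g y ∉ span L {g o} := notMem_span_left hy
  have hi : LinearIndependent L ![g o, g x, g y] :=
    linearIndependent_triple_iff_notMem.2 ⟨ho, hx, hy⟩
  have hxy : g (x + y) ∉ span L {g o} := by
    rw [add_comm]
    exact notMem_span_left (hg.add_notMem hy (right_mem_span_pair _ _))
  exact isLift_unique ho hxy (hg.isLift_of_isShift hr ho hxy hu)
    (hg.isLift_add hi (hg.isLift_of_isShift hr ho hx hv) (hg.isLift_of_isShift hr ho hyo hw))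

theorem exists_semilinear :
    ∃ (σ : K →+* L) (Φ : V →ₛₗ[σ] W), ∀ x, span L {g x} = span L {Φ x} := by
  obtain ⟨o, ho⟩ := hr 0 0
  replace ho : g o ≠ 0 := by simpa using ho
  have hex : ∀ x, ∃ v, IsShift L g o x v := fun x => by
    by_cases hx : g x ∈ span L {g o}
    · exact hg.exists_isShift_of_mem hr ho hx
    · obtain ⟨v, hv⟩ := hg.exists_isLift ho hx
      exact ⟨v, hg.isShift_of_isLift ho hx hv⟩
  choose T hT using hex
  have hspan : ∀ x, span L {T x} = span L {g x} := fun x => hg.span_isShift_eq hr ho (hT x)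
  let Φ : V →+ W := AddMonoidHom.mk' T fun x y =>
    hg.eq_add_of_isShift hr ho (hT x) (hT y) (hT (x + y))
  have hrank : ∀ y : W, ∃ x, Φ x ∉ span L {y} := fun y => by
    obtain ⟨x, hx⟩ := hr y y
    exact ⟨x, fun h => notMem_span_left hx ((mem_iff_of_span_eq (hspan x)).1 h)⟩
  obtain ⟨σ, Ψ, hΨ⟩ := exists_semilinear_of_smul_mem_span Φ hrank fun (k : K) x =>
    (mem_iff_of_span_eq (hspan (k • x))).2 (hspan x ▸ hg.smul_mem k x)
  exact ⟨σ, Ψ, fun x => by rw [hΨ]; exact (hspan x).symm⟩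

end ProjectiveMorphism

end FundamentalTheorem

section AffineMorphism

variable {K V L W : Type*} [DivisionRing K] [AddCommGroup V] [Module K V]
  [DivisionRing L] [AddCommGroup W] [Module L W]

theorem exists_mem_span_pair_of_triangles {a b c a' b' c' d e : W}
    (hi : LinearIndependent L ![a, b, c]) (hi' : LinearIndependent L ![a', b', c'])
    (ha : a' ∉ span L {a}) (hdb : d ∉ span L {b}) (hd : d ∈ span L {a, b})
    (hd' : d ∈ span L {a', b'}) (he : e ∈ span L {b, c}) (he' : e ∈ span L {b', c'})
    (hde : d + e ∈ span L {a, c}) (hde' : d + e ∈ span L {a', c'}) :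
    ∃ m ≠ 0, m ∈ span L {a, a'} ∧ m ∈ span L {b, b'} ∧ m ∈ span L {c, c'} := by
  have hmid : ∀ {a b c : W} {α β γ δ : L}, LinearIndependent L ![a, b, c] → α • a + β • b = d →
      γ • b + δ • c = e → d + e ∈ span L {a, c} → γ = -β := by
    rintro a b c α β γ δ hi rfl rfl hde
    obtain ⟨ε, ζ, h⟩ := mem_span_pair.1 hde
    refine eq_neg_of_add_eq_zero_right (eq_of_linearIndependent_triple hi (a := α) (c := δ)
      (a' := ε) (b' := 0) (c' := ζ) ?_).2.1
    rw [zero_smul, add_zero, h, add_smul]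
    abel
  obtain ⟨α, β, hd⟩ := mem_span_pair.1 hd
  obtain ⟨α', β', hd'⟩ := mem_span_pair.1 hd'
  obtain ⟨γ, δ, he⟩ := mem_span_pair.1 he
  obtain ⟨γ', δ', he'⟩ := mem_span_pair.1 he'
  obtain rfl := hmid hi hd he hde
  obtain rfl := hmid hi' hd' he' hde'
  have hb : α • a - α' • a' = β' • b' - β • b := by
    rw [sub_eq_sub_iff_add_eq_add, hd, add_comm, hd']
  have hc : α • a - α' • a' = δ' • c' - δ • c := by
    rw [hb, sub_eq_sub_iff_add_eq_add, ← sub_eq_zero]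
    rw [neg_smul] at he he'
    rw [← sub_eq_zero.2 (he.trans he'.symm)]
    abel
  refine ⟨α • a - α' • a', fun h0 => ?_, ?_, hb ▸ ?_, hc ▸ ?_⟩
  · rw [sub_eq_zero] at h0
    obtain rfl | hα' := eq_or_ne α' 0
    · rw [h0, zero_smul, zero_add] at hd
      exact hdb (hd ▸ smul_mem_span_singleton _ _)
    · exact ha ((smul_mem_iff _ hα').1 (h0 ▸ smul_mem_span_singleton _ _))
  · exact sub_mem (smul_mem _ _ (left_mem_span_pair _ _)) (smul_mem _ _ (right_mem_span_pair _ _))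
  · exact sub_mem (smul_mem _ _ (right_mem_span_pair _ _)) (smul_mem _ _ (left_mem_span_pair _ _))
  · exact sub_mem (smul_mem _ _ (right_mem_span_pair _ _)) (smul_mem _ _ (left_mem_span_pair _ _))

variable (L) in
/-- A map of vector spaces representing, on the affine space where the linear form `h` does not
vanish, a morphism to a projective space. It is undefined where the map vanishes. -/
structure AffineMorphism (h : V →ₗ[K] K) (f : V → W) : Prop where
  mem_span : ∀ ⦃x y z w⦄, h x ≠ 0 → h y ≠ 0 → h z ≠ 0 → h w ≠ 0 → x ∈ span K {y, z, w} →
    f x ∈ span L {f y, f z, f w}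

namespace AffineMorphism

variable {h : V →ₗ[K] K} {f : V → W} (hf : AffineMorphism L h f) {a b c u v w x y z : V}
include hf

theorem mem_triple (hx : h x ≠ 0) (hy : h y ≠ 0) (hz : h z ≠ 0) (hw : h w ≠ 0) (r s t : K)
    (hxyzw : x = r • y + s • z + t • w) : f x ∈ span L {f y, f z, f w} :=
  hf.mem_span hx hy hz hw (mem_span_triple.2 ⟨r, s, t, hxyzw.symm⟩)

theorem mem_pair (hx : h x ≠ 0) (hy : h y ≠ 0) (hz : h z ≠ 0) (r s : K)
    (hxyz : x = r • y + s • z) : f x ∈ span L {f y, f z} := by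
  simpa using hf.mem_triple hx hy hz hz r s 0 (by simpa using hxyz)

theorem mem_singleton (hx : h x ≠ 0) (hy : h y ≠ 0) (r : K) (hxy : x = r • y) :
    f x ∈ span L {f y} := by
  simpa using hf.mem_pair hx hy hy r 0 (by simpa using hxy)

theorem span_smul_eq (hne : ∀ x, h x ≠ 0 → f x ≠ 0) (ha : h a ≠ 0) {k : K} (hk : k ≠ 0) :
    span L {f (k • a)} = span L {f a} :=
  have hka : h (k • a) ≠ 0 := by simp [ha, hk]
  span_singleton_eq_of_mem (hf.mem_singleton hka ha k rfl) (hne _ hka)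

theorem mem_line (ha : h a ≠ 0) (hu : h u = 0) {k : K} (hk : k ≠ 0) (j : K) :
    f (k • a + j • u) ∈ span L {f a, f (a + u)} := by
  refine hf.mem_pair (by simp [ha, hu, hk]) ha (by simp [ha, hu]) (k - j) j ?_
  match_scalars <;> simp

theorem add_smul_mem_line (ha : h a ≠ 0) (hu : h u = 0) (j : K) :
    f (a + j • u) ∈ span L {f a, f (a + u)} := by
  simpa using hf.mem_line ha hu one_ne_zero j

theorem line_eq (ha : h a ≠ 0) (hu : h u = 0) {k : K} (hk : k ≠ 0) (j : K) :
    span L {f (k • a + j • u), f (k • a + j • u + u)} = span L {f a, f (a + u)} := by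
  have hle : ∀ {a : V} {k : K} (j : K), h a ≠ 0 → k ≠ 0 →
      span L {f (k • a + j • u), f (k • a + j • u + u)} ≤ span L {f a, f (a + u)} := by
    intro a k j ha hk
    refine span_le.2 (Set.insert_subset (hf.mem_line ha hu hk j)
      (Set.singleton_subset_iff.2 ?_))
    have := hf.mem_line ha hu hk (j + 1)
    rwa [add_smul, one_smul, ← add_assoc] at this
  refine le_antisymm (hle j ha hk) ?_
  have hge := hle (a := k • a + j • u) (k := k⁻¹) (-(k⁻¹ * j)) (by simp [hk, ha, hu])
    (inv_ne_zero hk)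
  have hback : k⁻¹ • (k • a + j • u) + -(k⁻¹ * j) • u = a := by
    match_scalars <;> simp [hk]
  rwa [hback] at hge

theorem smul_line_eq (ha : h a ≠ 0) (hu : h u = 0) {k : K} (hk : k ≠ 0) :
    span L {f (k • a), f (k • a + u)} = span L {f a, f (a + u)} := by
  simpa using hf.line_eq ha hu hk 0

theorem add_line_eq (ha : h a ≠ 0) (hu : h u = 0) :
    span L {f (a + u), f (a + u + u)} = span L {f a, f (a + u)} := by
  simpa using hf.line_eq ha hu one_ne_zero 1

theorem linearIndependent_add (ha : h a ≠ 0) (hb : h b ≠ 0) (hu : h u = 0)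
    (hi : LinearIndependent L ![f a, f (a + u), f b]) :
    LinearIndependent L ![f a, f (a + u), f (b + u)] := by
  rw [linearIndependent_triple_iff_notMem] at hi ⊢
  refine ⟨hi.1, hi.2.1, fun hbu => hi.2.2 ?_⟩
  refine mem_of_mem_span_triple (hf.mem_triple hb (y := b + u) (z := a) (w := a + u)
    (by simp [hb, hu]) ha (by simp [ha, hu]) 1 1 (-1) ?_) hbu (left_mem_span_pair _ _)
    (right_mem_span_pair _ _)
  match_scalars <;> simp

theorem add_notMem_of_linearIndependent {k : K} (hk0 : k ≠ 0) (hk1 : k ≠ 1) (ha : h a ≠ 0)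
    (hb : h b ≠ 0) (hu : h u = 0) (hi : LinearIndependent L ![f a, f (a + u), f b]) :
    f (b + u) ∉ span L {f b} := by
  intro hbu
  obtain ⟨t, ht0, ht⟩ : ∃ t : K, t ≠ 0 ∧ h a + t * h b ≠ 0 := by
    refine ⟨-(k * (h a * (h b)⁻¹)), by simp [*], ?_⟩
    have : h a + -(k * (h a * (h b)⁻¹)) * h b = (1 - k) * h a := by
      rw [sub_mul, neg_mul, mul_assoc, mul_assoc, inv_mul_cancel₀ hb]; simp [sub_eq_add_neg]
    rw [this]
    exact mul_ne_zero (sub_ne_zero.2 hk1.symm) ha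
  have hbt : f (b + (-t⁻¹) • u) ∈ span L {f b} :=
    mem_of_mem_span_pair (hf.add_smul_mem_line hb hu _) (mem_span_singleton_self _) hbu
  have hm : h (a + t • b) ≠ 0 := by simpa using ht
  have hm_ab : f (a + t • b) ∈ span L {f a, f b} := hf.mem_pair hm ha hb 1 t (by simp)
  have hm_aub : f (a + t • b) ∈ span L {f (a + u), f b} := by
    refine mem_of_mem_span_pair (hf.mem_pair hm (y := a + u) (z := b + (-t⁻¹) • u)
      (by simp [ha, hu]) (by simp [hb, hu]) 1 t ?_) (left_mem_span_pair _ _)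
      (mem_of_mem_span_singleton hbt (right_mem_span_pair _ _))
    match_scalars <;> simp [ht0]
  obtain ⟨p, q, hpq⟩ := mem_span_pair.1 hm_ab
  obtain ⟨p', q', hpq'⟩ := mem_span_pair.1 hm_aub
  obtain ⟨rfl, -, -⟩ := eq_of_linearIndependent_triple hi
    (a := p) (b := 0) (c := q) (a' := 0) (b' := p') (c' := q') (by simp [hpq, hpq'])
  rw [zero_smul, zero_add] at hpq
  have hab : f a ∈ span L {f b} := by
    refine mem_of_mem_span_pair (hf.mem_pair ha hm hb 1 (-t) ?_)
      (hpq ▸ smul_mem_span_singleton _ _) (mem_span_singleton_self _)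
    match_scalars <;> simp
  obtain ⟨ha0, -, hb_line⟩ := linearIndependent_triple_iff_notMem.1 hi
  exact hb_line (mem_of_mem_span_singleton (mem_span_singleton_symm hab ha0)
    (left_mem_span_pair _ _))

theorem linearIndependent_parallel {k : K} (hk0 : k ≠ 0) (hk1 : k ≠ 1) (ha : h a ≠ 0)
    (hb : h b ≠ 0) (hu : h u = 0) (hi : LinearIndependent L ![f a, f (a + u), f b]) :
    LinearIndependent L ![f b, f (b + u), f a] := by
  have hb0 : f b ≠ 0 := hi.ne_zero 2
  refine linearIndependent_triple_iff_notMem.2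
    ⟨hb0, hf.add_notMem_of_linearIndependent hk0 hk1 ha hb hu hi, fun haN => ?_⟩
  obtain ⟨ha0, hau, hbl⟩ := linearIndependent_triple_iff_notMem.1 hi
  have hauN : f (a + u) ∈ span L {f b, f (b + u)} := by
    refine mem_of_mem_span_triple (hf.mem_triple (x := a + u) (y := b + u) (z := a) (w := b)
      (by simp [ha, hu]) (by simp [hb, hu]) ha hb 1 1 (-1) ?_) (right_mem_span_pair _ _) haN
      (left_mem_span_pair _ _)
    match_scalars <;> simp
  exact hbl (span_pair_eq_of_mem haN hauN ha0 hau ▸ left_mem_span_pair _ _)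

end AffineMorphism

end AffineMorphism

section ConcurrentLines

variable {K V L W : Type*} [DivisionRing K] [AddCommGroup V] [Module K V]
  [DivisionRing L] [AddCommGroup W] [Module L W]

namespace AffineMorphism

variable {h : V →ₗ[K] K} {f : V → W} (hf : AffineMorphism L h f) {a b c u : V} {k : K}
include hf

theorem exists_mem_span_of_linearIndependent_add (ha : h a ≠ 0) (hb : h b ≠ 0) (hc : h c ≠ 0)
    (hab : h a ≠ h b) (hac : h a ≠ h c) (hbc : h b ≠ h c) (hu : h u = 0)
    (hi : LinearIndependent L ![f a, f b, f c])
    (hi' : LinearIndependent L ![f (a + u), f (b + u), f (c + u)])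
    (hau : f (a + u) ∉ span L {f a}) :
    ∃ m ≠ 0, m ∈ span L {f a, f (a + u)} ∧ m ∈ span L {f b, f (b + u)} ∧
      m ∈ span L {f c, f (c + u)} := by
  have hsub : ∀ {x y : V}, h x ≠ 0 → h y ≠ 0 → h x ≠ h y → h (x - y) ≠ 0 ∧
      f (x - y) ∈ span L {f x, f y} ∧ f (x - y) ∈ span L {f (x + u), f (y + u)} := by
    intro x y hx hy hxy
    have hxy' : h (x - y) ≠ 0 := by simpa [sub_eq_zero] using hxy
    exact ⟨hxy', hf.mem_pair hxy' hx hy 1 (-1) (by simp [sub_eq_add_neg]),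
      hf.mem_pair hxy' (by simpa [hu] using hx) (by simpa [hu] using hy) 1 (-1)
        (by match_scalars <;> simp)⟩
  obtain ⟨hab0, hfab, hfab'⟩ := hsub ha hb hab
  obtain ⟨hbc0, hfbc, hfbc'⟩ := hsub hb hc hbc
  obtain ⟨hac0, hfac, hfac'⟩ := hsub ha hc hac
  obtain ⟨r, s, hrs⟩ := mem_span_pair.1 (hf.mem_pair hac0 hab0 hbc0 1 1 (by simp))
  have haN : f a ∉ span L {f b, f c} := by
    rw [linearIndependent_triple_iff_notMem] at hi
    exact fun haN => hi.2.2 (Set.pair_comm (f b) (f a) ▸ mem_span_pair_exchange' haN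
      fun hab => hi.2.1 (mem_span_singleton_symm hab hi.1))
  have hr : r ≠ 0 := by
    rintro rfl
    refine haN (mem_of_mem_span_pair (hf.mem_pair ha hac0 hc 1 1 (by simp)) ?_
      (right_mem_span_pair _ _))
    rw [← hrs, zero_smul, zero_add]
    exact smul_mem _ _ hfbc
  refine exists_mem_span_pair_of_triangles (d := r • f (a - b)) (e := s • f (b - c)) hi hi' hau
    (fun hd => haN ?_) (smul_mem _ _ hfab) (smul_mem _ _ hfab') (smul_mem _ _ hfbc)
    (smul_mem _ _ hfbc') (hrs ▸ hfac) (hrs ▸ hfac')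
  exact mem_of_mem_span_pair (hf.mem_pair ha hab0 hb 1 1 (by simp))
    (mem_of_mem_span_singleton ((smul_mem_iff _ hr).1 hd) (left_mem_span_pair _ _))
    (left_mem_span_pair _ _)

theorem mem_span_sub_of_not_linearIndependent (hne : ∀ x, h x ≠ 0 → f x ≠ 0) (ha : h a ≠ 0)
    (hb : h b ≠ 0) (hc : h c ≠ 0) (hab : h a ≠ h b) (hbc : h b ≠ h c) (hu : h u = 0)
    (hi : LinearIndependent L ![f a, f b, f c]) (hbu : f (b + u) ∉ span L {f (a + u)})
    (hd : ¬ LinearIndependent L ![f (a + u), f (b + u), f (c + u)]) :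
    f (a + u) ∈ span L {f (a - b), f (b - c)} := by
  have hD : ∀ {x}, h x ≠ 0 → h (x + u) ≠ 0 := fun hx => by simpa [hu] using hx
  have hab' : h (a - b) ≠ 0 := by simpa [sub_eq_zero] using hab
  have hbc' : h (b - c) ≠ 0 := by simpa [sub_eq_zero] using hbc
  have hcu : f (c + u) ∈ span L {f (a + u), f (b + u)} := by
    by_contra hcu
    exact hd (linearIndependent_triple_iff_notMem.2 ⟨hne _ (hD ha), hbu, hcu⟩)
  have hr : f (a - b) ∈ span L {f (a + u), f (b + u)} :=
    hf.mem_pair hab' (hD ha) (hD hb) 1 (-1) (by match_scalars <;> simp)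
  have hs : f (b - c) ∈ span L {f (a + u), f (b + u)} :=
    mem_of_mem_span_pair (hf.mem_pair hbc' (hD hb) (hD hc) 1 (-1)
      (by match_scalars <;> simp)) (right_mem_span_pair _ _) hcu
  rw [span_pair_eq_of_mem hr hs (hne _ hab') fun hrs =>
    (linearIndependent_triple_iff_notMem.1 hi).2.2 ?_]
  · exact left_mem_span_pair _ _
  have hbc_ab : f (b - c) ∈ span L {f a, f b} := mem_of_mem_span_singleton hrs
    (hf.mem_pair hab' ha hb 1 (-1) (by simp [sub_eq_add_neg]))
  exact mem_of_mem_span_pair (hf.mem_pair hc hb hbc' 1 (-1) (by simp))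
    (right_mem_span_pair _ _) hbc_ab

theorem exists_linearIndependent_add_smul (hne : ∀ x, h x ≠ 0 → f x ≠ 0) (hk0 : k ≠ 0)
    (hk1 : k ≠ 1) (ha : h a ≠ 0) (hb : h b ≠ 0) (hc : h c ≠ 0) (hab : h a ≠ h b)
    (hbc : h b ≠ h c) (hu : h u = 0) (hi : LinearIndependent L ![f a, f b, f c])
    (hbl : f b ∉ span L {f a, f (a + u)}) :
    ∃ j : K, j ≠ 0 ∧ LinearIndependent L ![f (a + j • u), f (b + j • u), f (c + j • u)] := by
  have hD : ∀ {x} (j : K), h x ≠ 0 → h (x + j • u) ≠ 0 := fun j hx => by simpa [hu] using hx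
  by_contra! hcon
  have hmem : ∀ j : K, j ≠ 0 → f (a + j • u) ∈ span L {f (a - b), f (b - c)} := by
    refine fun j hj => hf.mem_span_sub_of_not_linearIndependent hne ha hb hc hab hbc
      (by simp [hu]) hi (fun hbj => hbl ?_) (hcon j hj)
    refine mem_of_mem_span_triple (hf.mem_triple hb (y := b + j • u) (z := a) (w := a + u)
      (hD j hb) ha (by simp [ha, hu]) 1 j (-j) ?_) ?_ (left_mem_span_pair _ _)
      (right_mem_span_pair _ _)
    · match_scalars <;> simp
    · exact mem_of_mem_span_singleton hbj (hf.add_smul_mem_line ha hu j)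
  have hkne : 1 - k ≠ 0 := sub_ne_zero.2 hk1.symm
  have hab' : h (a - b) ≠ 0 := by simpa [sub_eq_zero] using hab
  have hbc' : h (b - c) ≠ 0 := by simpa [sub_eq_zero] using hbc
  have hfa : f a ∈ span L {f (a - b), f (b - c)} := by
    refine mem_of_mem_span_pair (hf.mem_pair ha (hD 1 ha) (hD k ha) (-(1 - k)⁻¹ * k)
      ((1 - k)⁻¹) ?_) (hmem 1 one_ne_zero) (hmem k hk0)
    match_scalars
    · have : -(1 - k)⁻¹ * k + (1 - k)⁻¹ = (1 - k)⁻¹ * (1 - k) := by noncomm_ring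
      simpa [hkne] using this.symm
    · simp
  have hfb : f b ∈ span L {f (a - b), f (b - c)} :=
    mem_of_mem_span_pair (hf.mem_pair hb ha hab' 1 (-1) (by simp)) hfa (left_mem_span_pair _ _)
  have hfc : f c ∈ span L {f (a - b), f (b - c)} :=
    mem_of_mem_span_pair (hf.mem_pair hc hb hbc' 1 (-1) (by simp)) hfb (right_mem_span_pair _ _)
  obtain ⟨ha0, hba, hcab⟩ := linearIndependent_triple_iff_notMem.1 hi
  exact hcab (span_pair_eq_of_mem hfa hfb ha0 hba ▸ hfc)

theorem exists_mem_span_of_ne (hne : ∀ x, h x ≠ 0 → f x ≠ 0) (hk0 : k ≠ 0) (hk1 : k ≠ 1)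
    (ha : h a ≠ 0) (hb : h b ≠ 0) (hc : h c ≠ 0) (hab : h a ≠ h b) (hac : h a ≠ h c)
    (hbc : h b ≠ h c) (hu : h u = 0) (hau : f (a + u) ∉ span L {f a})
    (hbl : f b ∉ span L {f a, f (a + u)}) (hi : LinearIndependent L ![f a, f b, f c]) :
    ∃ m ≠ 0, m ∈ span L {f a, f (a + u)} ∧ m ∈ span L {f b, f (b + u)} ∧
      m ∈ span L {f c, f (c + u)} := by
  obtain ⟨j, hj0, hj⟩ :=
    hf.exists_linearIndependent_add_smul hne hk0 hk1 ha hb hc hab hbc hu hi hbl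
  obtain ⟨m, hm, ham, hbm, hcm⟩ := hf.exists_mem_span_of_linearIndependent_add ha hb hc hab hac
    hbc (u := j • u) (by simp [hu]) hi hj (fun haj => hau <| by
      refine mem_of_mem_span_pair (hf.mem_pair (x := a + u) (by simp [ha, hu]) ha
        (by simpa [hu] using ha) (1 - j⁻¹) j⁻¹ ?_) (mem_span_singleton_self _) haj
      match_scalars <;> simp [hj0])
  have hle : ∀ {x}, h x ≠ 0 → m ∈ span L {f x, f (x + j • u)} → m ∈ span L {f x, f (x + u)} :=
    fun hx hm => mem_of_mem_span_pair hm (left_mem_span_pair _ _) (hf.add_smul_mem_line hx hu j)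
  exact ⟨m, hm, hle ha ham, hle hb hbm, hle hc hcm⟩

theorem exists_mem_span_of_linearIndependent (hne : ∀ x, h x ≠ 0 → f x ≠ 0) {α β : K}
    (hα0 : α ≠ 0) (hα1 : α ≠ 1) (hβ0 : β ≠ 0) (hβ1 : β ≠ 1) (hαβ : α ≠ β) (ha : h a ≠ 0)
    (hb : h b ≠ 0) (hc : h c ≠ 0) (hu : h u = 0) (hau : f (a + u) ∉ span L {f a})
    (hbl : f b ∉ span L {f a, f (a + u)}) (hi : LinearIndependent L ![f a, f b, f c]) :
    ∃ m ≠ 0, m ∈ span L {f a, f (a + u)} ∧ m ∈ span L {f b, f (b + u)} ∧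
      m ∈ span L {f c, f (c + u)} := by
  have hscale : ∀ {x : V} {κ : K}, h x ≠ 0 → κ ≠ 0 → ∃ k : K, k ≠ 0 ∧ h (k • x) = κ * h a :=
    fun {x κ} hx hκ => ⟨κ * h a * (h x)⁻¹, by simp [*], by simp [hx]⟩
  obtain ⟨k, hk, hkb⟩ := hscale hb hα0
  obtain ⟨l, hl, hlc⟩ := hscale hc hβ0
  have hfb := hf.span_smul_eq hne hb hk
  have hfc := hf.span_smul_eq hne hc hl
  rw [← hf.smul_line_eq hb hu hk, ← hf.smul_line_eq hc hu hl]
  refine hf.exists_mem_span_of_ne hne hα0 hα1 ha (by simp [*]) (by simp [*])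
    (fun h => hα1 ((mul_eq_right₀ ha).1 (h.trans hkb).symm))
    (fun h => hβ1 ((mul_eq_right₀ ha).1 (h.trans hlc).symm)) (by simp [hkb, hlc, ha, hαβ]) hu
    hau ((mem_iff_of_span_eq hfb).not.2 hbl) ((linearIndependent_triple_congr rfl hfb hfc).2 hi)

theorem exists_mem_span_of_four_le (hne : ∀ x, h x ≠ 0 → f x ≠ 0) {α β : K} (hα0 : α ≠ 0)
    (hα1 : α ≠ 1) (hβ0 : β ≠ 0) (hβ1 : β ≠ 1) (hαβ : α ≠ β) (ha : h a ≠ 0) (hb : h b ≠ 0)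
    (hc : h c ≠ 0) (hu : h u = 0) (hiab : LinearIndependent L ![f a, f (a + u), f b])
    (hiac : LinearIndependent L ![f a, f (a + u), f c]) :
    ∃ m ≠ 0, m ∈ span L {f a, f (a + u)} ∧ m ∈ span L {f b, f (b + u)} ∧
      m ∈ span L {f c, f (c + u)} := by
  obtain ⟨ha0, hau, hbl⟩ := linearIndependent_triple_iff_notMem.1 hiab
  wlog hcN : f c ∉ span L {f a, f b} generalizing c
  · rw [← hf.add_line_eq hc hu]
    refine this (c := c + u) (by simp [hc, hu]) (hf.linearIndependent_add ha hc hu hiac)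
      fun hcu => ?_
    obtain ⟨hc0, hcuc, hacu⟩ := linearIndependent_triple_iff_notMem.1
      (hf.linearIndependent_parallel hα0 hα1 ha hc hu hiac)
    exact hacu (span_pair_eq_of_mem (not_not.1 hcN) hcu hc0 hcuc ▸ left_mem_span_pair _ _)
  exact hf.exists_mem_span_of_linearIndependent hne hα0 hα1 hβ0 hβ1 hαβ ha hb hc hu hau hbl
    (linearIndependent_triple_iff_notMem.2
      ⟨ha0, fun hba => hbl (mem_of_mem_span_singleton hba (left_mem_span_pair _ _)), hcN⟩)

end AffineMorphism

end ConcurrentLines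

section HesseConfiguration

variable {K V L W : Type*} [DivisionRing K] [AddCommGroup V] [Module K V]
  [DivisionRing L] [AddCommGroup W] [Module L W]

section Vectors

variable {a b e p q r s t w x y z : W}

theorem exists_eq_add_add_of_mem_span (hw : w ∈ span L {x, y, z}) (hxy : w ∉ span L {x, y})
    (hxz : w ∉ span L {x, z}) (hyz : w ∉ span L {y, z}) :
    ∃ e a b, span L {e} = span L {x} ∧ span L {a} = span L {y} ∧ span L {b} = span L {z} ∧
      w = e + a + b := by
  obtain ⟨α, β, γ, rfl⟩ := mem_span_triple.1 hw
  have hα : α ≠ 0 := by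
    rintro rfl
    rw [zero_smul, zero_add] at hyz
    exact hyz (smul_add_smul_mem_span_pair _ _ _ _)
  have hβ : β ≠ 0 := by
    rintro rfl
    rw [zero_smul, add_zero] at hxz
    exact hxz (smul_add_smul_mem_span_pair _ _ _ _)
  have hγ : γ ≠ 0 := by
    rintro rfl
    rw [zero_smul, add_zero] at hxy
    exact hxy (smul_add_smul_mem_span_pair _ _ _ _)
  exact ⟨_, _, _, span_singleton_smul_eq hα.isUnit _, span_singleton_smul_eq hβ.isUnit _,
    span_singleton_smul_eq hγ.isUnit _, rfl⟩

theorem exists_span_singleton_eq_add_smul (hq : q ∈ span L {e, a}) (ha : a ∈ span L {e, q})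
    (hae : a ∉ span L {e}) : ∃ x : L, span L {q} = span L {a + x • e} := by
  obtain ⟨s, t, rfl⟩ := mem_span_pair.1 hq
  have ht : t ≠ 0 := by
    rintro rfl
    rw [zero_smul, add_zero] at ha
    exact hae (mem_of_mem_span_pair ha (mem_span_singleton_self _) (smul_mem_span_singleton _ _))
  refine ⟨t⁻¹ * s, ?_⟩
  rw [← span_singleton_smul_eq (inv_ne_zero ht).isUnit]
  congr 2
  rw [smul_add, smul_smul, smul_smul, inv_mul_cancel₀ ht, one_smul, add_comm]

theorem hesse_coordinates (hi : LinearIndependent L ![e, a, b]) {x y : L}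
    (hc : e + a + b ∈ span L {a + x • e, b + y • e}) (ht : t ∈ span L {a, e + a + b})
    (ht' : t ∈ span L {a + b, b + y • e}) (hq : a + x • e ∈ span L {b, t}) :
    x + y = 1 ∧ x = -(y * y) := by
  have hxy : x + y = 1 := by
    obtain ⟨p, q, h⟩ := mem_span_pair.1 hc
    obtain ⟨h1, rfl, rfl⟩ := eq_of_linearIndependent_triple hi (a := p * x + q * y) (b := p)
      (c := q) (a' := 1) (b' := 1) (c' := 1) (by
        simp only [one_smul, ← h]; match_scalars <;> simp)
    simpa using h1
  obtain ⟨p, q, rfl⟩ := mem_span_pair.1 ht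
  obtain ⟨p', q', h⟩ := mem_span_pair.1 ht'
  obtain ⟨hqy, hpq, hpq'⟩ := eq_of_linearIndependent_triple hi (a := q' * y) (b := p')
    (c := p' + q') (a' := q) (b' := p + q) (c' := q) (by
      trans p' • (a + b) + q' • (b + y • e)
      · match_scalars <;> simp
      · rw [h]; match_scalars <;> simp)
  obtain ⟨s, d, h⟩ := mem_span_pair.1 hq
  obtain ⟨hdx, hdp, -⟩ := eq_of_linearIndependent_triple hi (a := d * q) (b := d * (p + q))
    (c := s + d * q) (a' := x) (b' := 1) (c' := 0) (by
      trans a + x • e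
      · rw [← h]; match_scalars <;> simp [mul_add]
      · match_scalars <;> simp)
  have hdq : d * q' = -y := by
    rw [← hpq', mul_add, hpq, hdp] at hdx
    rw [← add_right_inj 1, hdx, ← hxy]
    abel
  exact ⟨hxy, by rw [← hdx, ← hqy, ← mul_assoc, hdq, neg_mul]⟩

theorem sub_mem_span_of_hesse (h3 : (3 : L) = 0) (hi : LinearIndependent L ![e, a, b])
    (hq : q ∈ span L {e, a}) (haq : a ∈ span L {e, q}) (hr : r ∈ span L {e, b})
    (hbr : b ∈ span L {e, r}) (hs : s ∈ span L {e, e + a + b}) (hs' : s ∈ span L {a, b})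
    (hc : e + a + b ∈ span L {q, r}) (ht : t ∈ span L {a, e + a + b}) (ht' : t ∈ span L {s, r})
    (hqt : q ∈ span L {b, t}) : a - e ∈ span L {q} := by
  obtain ⟨-, hae, hb⟩ := linearIndependent_triple_iff_notMem.1 hi
  obtain ⟨x, hx⟩ := exists_span_singleton_eq_add_smul hq haq hae
  obtain ⟨y, hy⟩ := exists_span_singleton_eq_add_smul hr hbr (notMem_span_left hb)
  have hsab : s ∈ span L {a + b} := mem_span_add_of_mem hi hs' hs
  have hby : t ∈ span L {a + b, b + y • e} :=
    mem_of_mem_span_pair ht' (mem_of_mem_span_singleton hsab (left_mem_span_pair _ _))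
      ((mem_iff_of_span_eq hy).2 (right_mem_span_pair _ _))
  obtain ⟨hxy, hxyy⟩ := hesse_coordinates hi (span_pair_congr hx hy ▸ hc) ht hby
    ((mem_iff_of_span_eq hx).1 hqt)
  have hy1 : (y + 1) * (y + 1) = 0 := by
    have h : (y + 1) * (y + 1) = 3 * y - (x + y) + 1 + (x - -(y * y)) := by noncomm_ring
    rw [h, h3, hxy, sub_eq_zero.2 hxyy]
    simp
  have hy' : y = -1 := eq_neg_of_add_eq_zero_left (mul_self_eq_zero.1 hy1)
  have hx' : x = -1 := by simpa [hy'] using hxyy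
  rw [hx, hx', neg_one_smul, ← sub_eq_add_neg]
  exact mem_span_singleton_self _

end Vectors

theorem add_add_self_eq_zero (h3 : (3 : K) = 0) (v : V) : v + v + v = 0 := by
  rw [← two_smul K, ← one_smul K v, ← mul_smul, ← add_smul, mul_one, two_add_one_eq_three, h3,
    zero_smul]

namespace AffineMorphism

variable {h : V →ₗ[K] K} {f : V → W} (hf : AffineMorphism L h f) {a b c u x y z : V}
include hf

theorem mem_of_add_add_eq_zero (hx : h x ≠ 0) (hy : h y ≠ 0) (hz : h z ≠ 0)
    (hxyz : x + y + z = 0) : f x ∈ span L {f y, f z} := by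
  refine hf.mem_pair hx hy hz (-1) (-1) ?_
  rw [neg_one_smul, neg_one_smul, ← neg_add, eq_neg_iff_add_eq_zero, ← add_assoc, hxyz]

theorem exists_eq_add_add (ha : h a ≠ 0) (hb : h b ≠ 0) (hu : h u = 0)
    (hi : LinearIndependent L ![f a, f (a + u), f b]) :
    ∃ e a' b', span L {e} = span L {f a} ∧ span L {a'} = span L {f (a + u)} ∧
      span L {b'} = span L {f b} ∧ f (b + u) = e + a' + b' := by
  have hau : h (a + u) ≠ 0 := by simp [ha, hu]
  have hbu : h (b + u) ≠ 0 := by simp [hb, hu]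
  refine exists_eq_add_add_of_mem_span
    (hf.mem_triple hbu ha hau hb (-1) 1 1 (by match_scalars <;> simp)) ?_ ?_ ?_
  · exact (linearIndependent_triple_iff_notMem.1 (hf.linearIndependent_add ha hb hu hi)).2.2
  · intro hbu_mem
    have hau_mem : f (a + u) ∈ span L {f a, f b} :=
      mem_of_mem_span_triple (hf.mem_triple hau ha hb hbu 1 (-1) 1 (by match_scalars <;> simp))
        (left_mem_span_pair _ _) (right_mem_span_pair _ _) hbu_mem
    obtain ⟨-, hau, hb⟩ := linearIndependent_triple_iff_notMem.1 hi
    exact hb (mem_span_pair_exchange' hau_mem hau)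
  · intro hbu_mem
    have ha_mem : f a ∈ span L {f (a + u), f b} :=
      mem_of_mem_span_triple (hf.mem_triple ha hau hb hbu 1 1 (-1) (by match_scalars <;> simp))
        (left_mem_span_pair _ _) (right_mem_span_pair _ _) hbu_mem
    obtain ⟨ha0, hau, hb⟩ := linearIndependent_triple_iff_notMem.1 hi
    exact hb (Set.pair_comm (f (a + u)) (f a) ▸ mem_span_pair_exchange' ha_mem
      fun ha => hau (mem_span_singleton_symm ha ha0))

/- The affine plane through `a`, `a + u`, `b` has nine points when `K` has three elements; their
images form a Hesse configuration, which is the standard one up to a choice of coordinates. -/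
theorem sub_mem_span_of_three_eq_zero (h3 : (3 : K) = 0) (h3' : (3 : L) = 0) (ha : h a ≠ 0)
    (hb : h b = h a) (hu : h u = 0) (hi : LinearIndependent L ![f a, f (a + u), f b])
    {e a' b' : W} (hea : span L {e} = span L {f a}) (hau' : span L {a'} = span L {f (a + u)})
    (hbb : span L {b'} = span L {f b}) (hc : f (b + u) = e + a' + b') :
    a' - e ∈ span L {f (a - u)} := by
  have h3V : ∀ v : V, v + v + v = 0 := add_add_self_eq_zero h3
  have hha : -h a - h a = h a := by
    rw [sub_eq_iff_eq_add, neg_eq_iff_add_eq_zero, ← add_assoc, add_add_self_eq_zero h3]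
  have hb0 : h b ≠ 0 := hb ▸ ha
  have hau : h (a + u) ≠ 0 := by simp [ha, hu]
  have hbu : h (b + u) ≠ 0 := by simp [hb, ha, hu]
  have hq : h (a - u) ≠ 0 := by simp [ha, hu]
  have hr : h (-a - b) ≠ 0 := by simp [hb, hha, ha]
  have hs : h (-a - b - u) ≠ 0 := by simp [hb, hha, hu, ha]
  have ht : h (-a - b + u) ≠ 0 := by simp [hb, hha, hu, ha]
  refine sub_mem_span_of_hesse h3' (b := b') (r := f (-a - b)) (s := f (-a - b - u))
    (t := f (-a - b + u)) ((linearIndependent_triple_congr hea hau' hbb).2 hi)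
    ?_ ?_ ?_ ?_ ?_ ?_ ?_ ?_ ?_ ?_
  · rw [span_pair_congr hea hau']
    exact hf.mem_of_add_add_eq_zero hq ha hau (by rw [← h3V a]; abel)
  · rw [mem_iff_of_span_eq hau', span_pair_congr hea rfl]
    exact hf.mem_of_add_add_eq_zero hau ha hq (by rw [← h3V a]; abel)
  · rw [span_pair_congr hea hbb]
    exact hf.mem_of_add_add_eq_zero hr ha hb0 (by abel)
  · rw [mem_iff_of_span_eq hbb, span_pair_congr hea rfl]
    exact hf.mem_of_add_add_eq_zero hb0 ha hr (by abel)
  · rw [span_pair_congr hea rfl, ← hc]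
    exact hf.mem_of_add_add_eq_zero hs ha hbu (by abel)
  · rw [span_pair_congr hau' hbb]
    exact hf.mem_of_add_add_eq_zero hs hau hb0 (by abel)
  · rw [← hc]
    exact hf.mem_of_add_add_eq_zero hbu hq hr (by abel)
  · rw [span_pair_congr hau' rfl, ← hc]
    exact hf.mem_of_add_add_eq_zero ht hau hbu (by rw [← h3V u]; abel)
  · exact hf.mem_of_add_add_eq_zero ht hs hr (by rw [← neg_zero, ← h3V (a + b)]; abel)
  · rw [span_pair_congr hbb rfl]
    exact hf.mem_of_add_add_eq_zero hq hb0 ht (by abel)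

theorem exists_harmonic (h3 : (3 : K) = 0) (h3' : (3 : L) = 0) (ha : h a ≠ 0) (hb : h b = h a)
    (hu : h u = 0) (hi : LinearIndependent L ![f a, f (a + u), f b]) :
    ∃ x y, span L {x} = span L {f a} ∧ span L {y} = span L {f (a + u)} ∧
      x + y ∈ span L {f (a - u)} ∧ y - x ∈ span L {f b, f (b + u)} := by
  obtain ⟨e, a', b', hea, hau', hbb, hc⟩ := hf.exists_eq_add_add ha (hb ▸ ha) hu hi
  refine ⟨-e, a', by rw [← Set.neg_singleton, span_neg, hea], hau', ?_, ?_⟩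
  · rw [neg_add_eq_sub]
    exact hf.sub_mem_span_of_three_eq_zero h3 h3' ha hb hu hi hea hau' hbb hc
  · rw [sub_neg_eq_add, add_comm a', eq_sub_of_add_eq hc.symm]
    exact sub_mem (right_mem_span_pair _ _)
      (mem_of_mem_span_singleton (span_singleton_eq_iff.1 hbb).1 (left_mem_span_pair _ _))

theorem exists_mem_span_of_three_eq_zero (hne : ∀ x, h x ≠ 0 → f x ≠ 0) (h3 : (3 : K) = 0)
    (h3' : (3 : L) = 0) (ha : h a ≠ 0) (hb : h b ≠ 0) (hc : h c ≠ 0) (hu : h u = 0)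
    (hiab : LinearIndependent L ![f a, f (a + u), f b])
    (hiac : LinearIndependent L ![f a, f (a + u), f c]) :
    ∃ m ≠ 0, m ∈ span L {f a, f (a + u)} ∧ m ∈ span L {f b, f (b + u)} ∧
      m ∈ span L {f c, f (c + u)} := by
  have hharm : ∀ {b}, h b ≠ 0 → LinearIndependent L ![f a, f (a + u), f b] →
      ∃ x y, span L {x} = span L {f a} ∧ span L {y} = span L {f (a + u)} ∧
        x + y ∈ span L {f (a - u)} ∧ y - x ∈ span L {f b, f (b + u)} := by
    intro b hb hi
    have hk : h a * (h b)⁻¹ ≠ 0 := mul_ne_zero ha (inv_ne_zero hb)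
    rw [← hf.smul_line_eq hb hu hk]
    exact hf.exists_harmonic h3 h3' ha (by simp [hb]) hu
      ((linearIndependent_triple_congr rfl rfl (hf.span_smul_eq hne hb hk)).2 hi)
  obtain ⟨x, y, hx, hy, hxy, hm⟩ := hharm hb hiab
  obtain ⟨x', y', hx', hy', hxy', hm'⟩ := hharm hc hiac
  obtain ⟨ha0, hau, -⟩ := linearIndependent_triple_iff_notMem.1 hiab
  have hxy_ind : LinearIndependent L ![x, y] := by
    rw [linearIndependent_pair_iff_notMem, hx, mem_iff_of_span_eq hy]
    refine ⟨fun h0 => ha0 ?_, hau⟩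
    rwa [h0, span_zero_singleton, eq_comm, span_singleton_eq_bot] at hx
  have hxy0 : x + y ≠ 0 := fun h0 => (linearIndependent_pair_iff_notMem.1 hxy_ind).2
    (eq_neg_of_add_eq_zero_right h0 ▸ neg_mem (mem_span_singleton_self _))
  obtain ⟨k, rfl, rfl⟩ := exists_smul_of_add_mem_span hxy_ind
    (hx ▸ hx' ▸ mem_span_singleton_self _) (hy ▸ hy' ▸ mem_span_singleton_self _)
    (span_singleton_eq_of_mem hxy hxy0 ▸ hxy')
  have hk : k ≠ 0 := by
    rintro rfl
    rw [zero_smul, span_zero_singleton, eq_comm, span_singleton_eq_bot] at hx'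
    exact ha0 hx'
  refine ⟨y - x, fun h0 => ?_, ?_, hm, (smul_mem_iff _ hk).1 (smul_sub k y x ▸ hm')⟩
  · exact (linearIndependent_pair_iff_notMem.1 hxy_ind).2
      (sub_eq_zero.1 h0 ▸ mem_span_singleton_self _)
  · rw [← span_pair_congr hx hy]
    exact sub_mem (right_mem_span_pair _ _) (left_mem_span_pair _ _)

end AffineMorphism

end HesseConfiguration

section PointsAtInfinity

variable {K V L W : Type*} [DivisionRing K] [AddCommGroup V] [Module K V]
  [DivisionRing L] [AddCommGroup W] [Module L W]

section Vectors

variable {e m p q w x y z : W} {s t : L}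

theorem mem_span_singleton_of_mem_span_pair (hz : z ∉ span L {x, y}) (hp : p ≠ 0)
    (hpxy : p ∈ span L {x, y}) (hpzw : p ∈ span L {z, w}) (hmxy : m ∈ span L {x, y})
    (hmzw : m ∈ span L {z, w}) : m ∈ span L {p} := by
  by_contra hm
  rw [← span_pair_eq_of_mem hpxy hmxy hp hm, span_pair_eq_of_mem hpzw hmzw hp hm] at hz
  exact hz (left_mem_span_pair _ _)

theorem notMem_span_pair_of_linearIndependent (hi : LinearIndependent L ![e, p, q]) :
    e ∉ span L {p, q} := by
  intro he
  obtain ⟨s, t, hst⟩ := mem_span_pair.1 he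
  exact one_ne_zero (eq_of_linearIndependent_triple hi (a := 1) (b := 0) (c := 0) (a' := 0)
    (b' := s) (c' := t) (by simp [hst])).1

theorem eq_of_mem_span_add_smul (hi : LinearIndependent L ![e, p, q]) (hw : w ≠ 0)
    (h : w ∈ span L {e + s • p + t • q}) (h' : w ∈ span L {e, e + p + q}) : s = t := by
  obtain ⟨x, y, hxy⟩ :=
    mem_span_pair.1 (mem_of_mem_span_singleton (mem_span_singleton_symm h hw) h')
  obtain ⟨-, rfl, rfl⟩ := eq_of_linearIndependent_triple hi (a := x + y) (b := y) (c := y)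
    (a' := 1) (b' := s) (c' := t) (by
      rw [one_smul, ← hxy, add_smul]
      simp only [smul_add]
      abel)
  rfl

theorem mem_span_pair_of_mem_span_add (hi : LinearIndependent L ![e, p, q]) (hs : s ≠ 1)
    (h : m ∈ span L {e + p, e + q}) (h' : m ∈ span L {e + s • p, e + s • q}) :
    m ∈ span L {p, q} := by
  obtain ⟨x, y, rfl⟩ := mem_span_pair.1 h
  obtain ⟨z, w, hzw⟩ := mem_span_pair.1 h'
  obtain ⟨hxy, hx, hy⟩ := eq_of_linearIndependent_triple hi (a := x + y) (b := x) (c := y)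
    (a' := z + w) (b' := z * s) (c' := w * s) (by
      have hexpand : (z + w) • e + (z * s) • p + (w * s) • q =
          z • (e + s • p) + w • (e + s • q) := by
        simp only [smul_add, add_smul, mul_smul]; abel
      rw [hexpand, hzw]
      simp only [smul_add, add_smul]
      abel)
  have hsum : (x + y) * (s - 1) = 0 := by
    nth_rewrite 1 [hxy]
    rw [mul_sub, add_mul, ← hx, ← hy, mul_one, hxy, sub_self]
  have hxy0 : x + y = 0 := (mul_eq_zero.1 hsum).resolve_right (sub_ne_zero.2 hs)
  have hm : x • (e + p) + y • (e + q) = (x + y) • e + (x • p + y • q) := by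
    simp only [smul_add, add_smul]; abel
  rw [hm, hxy0, zero_smul, zero_add]
  exact smul_add_smul_mem_span_pair _ _ _ _

end Vectors

variable (L) in
/-- `p` represents the common point at infinity of the images under `f` of the lines with
direction `u`. It vanishes if `f` collapses these lines. -/
def IsDirection (h : V →ₗ[K] K) (f : V → W) (u : V) (p : W) : Prop :=
  ∀ a, h a ≠ 0 → p ∈ span L {f a, f (a + u)} ∧ f (a + u) ∈ span L {f a, p}

variable {h : V →ₗ[K] K} {f : V → W} (hf : AffineMorphism L h f) {a u v : V} {k : K}
  {m p q : W}

include hf in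
theorem AffineMorphism.exists_isDirection (hne : ∀ x, h x ≠ 0 → f x ≠ 0) (hk0 : k ≠ 0)
    (hk1 : k ≠ 1) (hr : ∀ y z : W, ∃ x, h x ≠ 0 ∧ f x ∉ span L {y, z}) (hu : h u = 0)
    (hlines : ∀ {a b c}, h a ≠ 0 → h b ≠ 0 → h c ≠ 0 → LinearIndependent L ![f a, f (a + u), f b] →
      LinearIndependent L ![f a, f (a + u), f c] → ∃ m ≠ 0, m ∈ span L {f a, f (a + u)} ∧
        m ∈ span L {f b, f (b + u)} ∧ m ∈ span L {f c, f (c + u)}) :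
    ∃ p, IsDirection L h f u p := by
  by_cases hcol : ∀ a, h a ≠ 0 → f (a + u) ∈ span L {f a}
  · exact ⟨0, fun a ha => ⟨zero_mem _,
      mem_of_mem_span_singleton (hcol a ha) (left_mem_span_pair _ _)⟩⟩
  push Not at hcol
  obtain ⟨a, ha, hau⟩ := hcol
  have hli : ∀ {a b}, h a ≠ 0 → f (a + u) ∉ span L {f a} → f b ∉ span L {f a, f (a + u)} →
      LinearIndependent L ![f a, f (a + u), f b] := fun ha hau hb =>
    linearIndependent_triple_iff_notMem.2 ⟨hne _ ha, hau, hb⟩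
  obtain ⟨b, hb, hab⟩ := hr (f a) (f (a + u))
  have hiab := hli ha hau hab
  have hiba := hf.linearIndependent_parallel hk0 hk1 ha hb hu hiab
  obtain ⟨-, hbu, -⟩ := linearIndependent_triple_iff_notMem.1 hiba
  obtain ⟨p, hp0, hpa, hpb, -⟩ := hlines ha hb hb hiab hiab
  have hinter : ∀ m ≠ 0, m ∈ span L {f a, f (a + u)} → m ∈ span L {f b, f (b + u)} →
      p ∈ span L {m} := fun m hm hma hmb =>
    mem_span_singleton_of_mem_span_pair hab hm hma hmb hpa hpb
  have hmem : ∀ c, h c ≠ 0 → p ∈ span L {f c, f (c + u)} := by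
    intro c hc
    by_cases hca : f c ∈ span L {f a, f (a + u)}
    · by_cases hcb : f c ∈ span L {f b, f (b + u)}
      · exact mem_of_mem_span_singleton (hinter _ (hne c hc) hca hcb) (left_mem_span_pair _ _)
      · obtain ⟨m, hm0, hmb, hma, hmc⟩ := hlines hb ha hc hiba (hli hb hbu hcb)
        exact mem_of_mem_span_singleton (hinter m hm0 hma hmb) hmc
    · obtain ⟨m, hm0, hma, hmb, hmc⟩ := hlines ha hb hc hiab (hli ha hau hca)
      exact mem_of_mem_span_singleton (hinter m hm0 hma hmb) hmc
  refine ⟨p, fun c hc => ⟨hmem c hc, ?_⟩⟩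
  by_cases hcu : f (c + u) ∈ span L {f c}
  · exact mem_of_mem_span_singleton hcu (left_mem_span_pair _ _)
  refine mem_span_pair_exchange' (hmem c hc) fun hpc => ?_
  obtain ⟨d, hd, hcd⟩ := hr (f c) (f (c + u))
  have hidc := hf.linearIndependent_parallel hk0 hk1 hc hd hu (hli hc hcu hcd)
  exact (linearIndependent_triple_iff_notMem.1 hidc).2.2
    (mem_of_mem_span_singleton (mem_span_singleton_symm hpc hp0) (hmem d hd))

namespace IsDirection

theorem mem_span_singleton_of_isDirection
    (hr : ∀ y z : W, ∃ x, h x ≠ 0 ∧ f x ∉ span L {y, z})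
    (hp : IsDirection L h f u p) (hq : IsDirection L h f u q) : q ∈ span L {p} := by
  by_contra hpq
  obtain ⟨a, ha, hfa⟩ := hr q p
  exact hfa <| mem_span_pair_exchange
    (mem_of_mem_span_pair (hq a ha).1 (left_mem_span_pair _ _) (hp a ha).2) hpq

theorem smul_right (hp : IsDirection L h f u p) {s : L} (hs : s ≠ 0) :
    IsDirection L h f u (s • p) := fun a ha =>
  ⟨smul_mem _ _ (hp a ha).1, mem_of_mem_span_pair (hp a ha).2 (left_mem_span_pair _ _)
    ((smul_mem_iff _ hs).1 (right_mem_span_pair _ _))⟩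

include hf

theorem smul_left (hp : IsDirection L h f u p) (hu : h u = 0) (hk : k ≠ 0) :
    IsDirection L h f (k • u) p := fun a ha => by
  have hline := hf.add_smul_mem_line (u := k • u) ha (by simp [hu]) k⁻¹
  rw [inv_smul_smul₀ hk] at hline
  exact ⟨mem_of_mem_span_pair (hp a ha).1 (left_mem_span_pair _ _) hline,
    mem_of_mem_span_pair (hf.add_smul_mem_line ha hu k) (left_mem_span_pair _ _) (hp a ha).2⟩

theorem neg_left (hp : IsDirection L h f u p) (hu : h u = 0) : IsDirection L h f (-u) p := by
  simpa using hp.smul_left hf hu (k := -1) (by simp)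

theorem apply_mem (hp : IsDirection L h f u p) (hu : h u = 0) (ha : h a ≠ 0) :
    f a ∈ span L {f (a + u), p} := by
  simpa using (hp.neg_left hf hu (a + u) (by simpa [hu] using ha)).2

theorem exists_add_smul (hp : IsDirection L h f u p) (hu : h u = 0) (ha : h a ≠ 0)
    (hap : f a ∉ span L {p}) (hpa : p ∉ span L {f a}) :
    ∃ s : L, s ≠ 0 ∧ f (a + u) ∈ span L {f a + s • p} := by
  obtain ⟨s, t, hst⟩ := mem_span_pair.1 (hp a ha).2
  have hs : s ≠ 0 := by
    rintro rfl
    rw [zero_smul, zero_add] at hst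
    exact hap (mem_of_mem_span_pair (hp.apply_mem hf hu ha) (hst ▸ smul_mem_span_singleton _ _)
      (mem_span_singleton_self _))
  have ht : t ≠ 0 := by
    rintro rfl
    rw [zero_smul, add_zero] at hst
    exact hpa (mem_of_mem_span_pair (hp a ha).1 (mem_span_singleton_self _)
      (hst ▸ smul_mem_span_singleton _ _))
  refine ⟨s⁻¹ * t, by simp [hs, ht], mem_span_singleton.2 ⟨s, ?_⟩⟩
  rw [smul_add, smul_smul, mul_inv_cancel_left₀ hs, hst]

omit hf in
theorem add_add_mem (hp : IsDirection L h f u p) (hq : IsDirection L h f v q) (hu : h u = 0)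
    (hv : h v = 0) (ha : h a ≠ 0) (hi : LinearIndependent L ![f a, p, q])
    (hau : f (a + u) ∈ span L {f a + p}) (hav : f (a + v) ∈ span L {f a + q}) :
    f (a + u + v) ∈ span L {f a + p + q} := by
  refine mem_span_add_add hi ?_ ?_
  · exact mem_of_mem_span_pair (hq (a + u) (by simpa [hu] using ha)).2
      (mem_of_mem_span_singleton hau (left_mem_span_pair _ _)) (right_mem_span_pair _ _)
  · rw [add_right_comm]
    exact mem_of_mem_span_pair (hp (a + v) (by simpa [hv] using ha)).2
      (mem_of_mem_span_singleton hav (left_mem_span_pair _ _)) (right_mem_span_pair _ _)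

theorem apply_add_add_ne_zero (hp : IsDirection L h f u p) (hq : IsDirection L h f v q)
    (hu : h u = 0) (hv : h v = 0) (ha : h a ≠ 0) (hpq : f a ∉ span L {p, q}) :
    f (a + u + v) ≠ 0 := fun h0 => by
  have hau := hq.apply_mem hf hv (a := a + u) (by simpa [hu] using ha)
  rw [h0, span_insert_zero] at hau
  exact hpq (mem_of_mem_span_pair (hp.apply_mem hf hu ha)
    (mem_of_mem_span_singleton hau (right_mem_span_pair _ _)) (left_mem_span_pair _ _))

theorem exists_add_smul_add_smul (hp : IsDirection L h f u p) (hq : IsDirection L h f v q)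
    (hu : h u = 0) (hv : h v = 0) (hk0 : k ≠ 0) (hk1 : k ≠ 1) (ha : h a ≠ 0)
    (hi : LinearIndependent L ![f a, p, q]) (hau : f (a + u) ∈ span L {f a + p})
    (hav : f (a + v) ∈ span L {f a + q}) :
    ∃ s : L, s ≠ 1 ∧ f (a + k • u) ∈ span L {f a + s • p} ∧
      f (a + k • v) ∈ span L {f a + s • q} := by
  have hku : h (k • u) = 0 := by simp [hu]
  have hkv : h (k • v) = 0 := by simp [hv]
  have hpk := hp.smul_left hf hu hk0
  have hqk := hq.smul_left hf hv hk0
  have hpq := notMem_span_pair_of_linearIndependent hi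
  obtain ⟨ha0, hpa, hqa⟩ := linearIndependent_triple_iff_notMem.1 hi
  obtain ⟨s, hs0, hs⟩ := hpk.exists_add_smul hf hku ha (notMem_span_left hpq) hpa
  obtain ⟨t, ht0, ht⟩ := hqk.exists_add_smul hf hkv ha (notMem_span_right hpq)
    (notMem_span_left hqa)
  have hst : s = t := by
    refine eq_of_mem_span_add_smul hi (hpk.apply_add_add_ne_zero hf hqk hku hkv ha hpq)
      ((hpk.smul_right hs0).add_add_mem (hqk.smul_right ht0) hku hkv ha ?_ hs ht) ?_
    · exact (linearIndependent_triple_congr rfl (span_singleton_smul_eq hs0.isUnit p)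
        (span_singleton_smul_eq ht0.isUnit q)).2 hi
    · have hline := hf.add_smul_mem_line (u := u + v) ha (by simp [hu, hv]) k
      rw [smul_add, ← add_assoc, ← add_assoc] at hline
      exact mem_of_mem_span_pair hline (left_mem_span_pair _ _) (mem_of_mem_span_singleton
        (hp.add_add_mem hq hu hv ha hi hau hav) (right_mem_span_pair _ _))
  refine ⟨s, ?_, hs, hst ▸ ht⟩
  rintro rfl
  rw [one_smul] at hs
  have hk : k - 1 ≠ 0 := sub_ne_zero.2 hk1
  have hline := hf.mem_pair ha (y := a + u) (z := a + k • u) (by simpa [hu] using ha)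
    (by simpa [hu] using ha) ((k - 1)⁻¹ * k) (-(k - 1)⁻¹) (by
      match_scalars
      · rw [mul_one, mul_one, ← sub_eq_add_neg, ← mul_sub_one, inv_mul_cancel₀ hk]
      · simp)
  have hap : f a ∈ span L {f a + p} := mem_of_mem_span_pair hline hau hs
  exact hpa ((add_mem_cancel_left (mem_span_singleton_self _)).1 (mem_span_singleton_symm hap ha0))

/- The directions `p` and `q` are normalised so that `f` maps the parallelogram with vertices `a`,
`a + u`, `a + v` to a parallelogram. It then does so as well for the multiples by `k`, whence the
direction of the diagonals is `p - q`. -/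
theorem sub_mem_of_linearIndependent (hp : IsDirection L h f u p) (hq : IsDirection L h f v q)
    (hm : IsDirection L h f (u - v) m) (hu : h u = 0) (hv : h v = 0) (hk0 : k ≠ 0) (hk1 : k ≠ 1)
    (ha : h a ≠ 0) (hi : LinearIndependent L ![f a, p, q]) (hau : f (a + u) ∈ span L {f a + p})
    (hav : f (a + v) ∈ span L {f a + q}) : m ∈ span L {p, q} := by
  obtain ⟨s, hs, hsu, hsv⟩ := hp.exists_add_smul_add_smul hf hq hu hv hk0 hk1 ha hi hau hav
  refine mem_span_pair_of_mem_span_add hi hs ?_ ?_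
  · have hmv := (hm (a + v) (by simpa [hv] using ha)).1
    rw [add_assoc, add_sub_cancel] at hmv
    exact mem_of_mem_span_pair hmv (mem_of_mem_span_singleton hav (right_mem_span_pair _ _))
      (mem_of_mem_span_singleton hau (left_mem_span_pair _ _))
  · have hmv := (hm.smul_left hf (by simp [hu, hv]) hk0 (a + k • v) (by simpa [hv] using ha)).1
    rw [smul_sub, add_assoc, add_sub_cancel] at hmv
    exact mem_of_mem_span_pair hmv (mem_of_mem_span_singleton hsv (right_mem_span_pair _ _))
      (mem_of_mem_span_singleton hsu (left_mem_span_pair _ _))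

theorem sub_mem_span_singleton (hr : ∀ y z : W, ∃ x, h x ≠ 0 ∧ f x ∉ span L {y, z})
    (hp : IsDirection L h f u p) (hq : IsDirection L h f v q) (hm : IsDirection L h f (u - v) m)
    (hu : h u = 0) (hv : h v = 0) {r : W} (hpr : p ∈ span L {r}) (hqr : q ∈ span L {r}) :
    m ∈ span L {r} := by
  by_contra hmr
  obtain ⟨a, ha, hfa⟩ := hr m r
  refine hfa (mem_span_pair_exchange (mem_of_mem_span_pair (hm a ha).1
    (left_mem_span_pair _ _) ?_) hmr)
  have hau := (hq.neg_left hf hv (a + u) (by simpa [hu] using ha)).2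
  rw [add_assoc, ← sub_eq_add_neg] at hau
  exact mem_of_mem_span_pair hau (mem_of_mem_span_pair (hp a ha).2 (left_mem_span_pair _ _)
    (mem_of_mem_span_singleton hpr (right_mem_span_pair _ _)))
    (mem_of_mem_span_singleton hqr (right_mem_span_pair _ _))

theorem sub_mem (hk0 : k ≠ 0) (hk1 : k ≠ 1)
    (hr : ∀ y z : W, ∃ x, h x ≠ 0 ∧ f x ∉ span L {y, z}) (hp : IsDirection L h f u p)
    (hq : IsDirection L h f v q) (hm : IsDirection L h f (u - v) m) (hu : h u = 0)
    (hv : h v = 0) : m ∈ span L {p, q} := by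
  by_cases hqp : q ∈ span L {p}
  · exact mem_of_mem_span_singleton (sub_mem_span_singleton hf hr hp hq hm hu hv
      (mem_span_singleton_self p) hqp) (left_mem_span_pair _ _)
  by_cases hpq : p ∈ span L {q}
  · exact mem_of_mem_span_singleton (sub_mem_span_singleton hf hr hp hq hm hu hv
      hpq (mem_span_singleton_self q)) (right_mem_span_pair _ _)
  obtain ⟨a, ha, hfa⟩ := hr p q
  have hpa : p ∉ span L {f a} := fun hpa =>
    notMem_span_left hfa (mem_span_singleton_symm hpa fun h0 => hpq (h0 ▸ zero_mem _))
  have hqa : q ∉ span L {f a, p} := fun hqa => hfa <| by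
    rw [Set.pair_comm]
    exact mem_span_pair_exchange hqa hqp
  have hi : LinearIndependent L ![f a, p, q] := linearIndependent_triple_iff_notMem.2
    ⟨fun h0 => hfa (h0 ▸ zero_mem _), hpa, hqa⟩
  obtain ⟨s, hs, hau⟩ := hp.exists_add_smul hf hu ha (notMem_span_left hfa) hpa
  obtain ⟨t, ht, hav⟩ := hq.exists_add_smul hf hv ha (notMem_span_right hfa)
    (notMem_span_left hqa)
  have hsp := span_singleton_smul_eq hs.isUnit p
  have htq := span_singleton_smul_eq ht.isUnit q
  rw [← span_pair_congr hsp htq]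
  exact (hp.smul_right hs).sub_mem_of_linearIndependent hf (hq.smul_right ht) hm hu hv hk0 hk1 ha
    ((linearIndependent_triple_congr rfl hsp htq).2 hi) hau hav

end IsDirection

end PointsAtInfinity

section AffineFundamentalTheorem

variable {K V L W : Type*} [DivisionRing K] [AddCommGroup V] [Module K V]
  [DivisionRing L] [AddCommGroup W] [Module L W]

/-- The condition on the division rings in the theorem: `K` has at least four elements, or both
`K` and `L` have characteristic three. -/
def FourLeCardOrThreeEqZero (K L : Type*) [DivisionRing K] [DivisionRing L] : Prop :=
  (∃ α β : K, α ≠ 0 ∧ α ≠ 1 ∧ β ≠ 0 ∧ β ≠ 1 ∧ α ≠ β) ∨ ((3 : K) = 0 ∧ (3 : L) = 0)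

theorem FourLeCardOrThreeEqZero.exists_ne_zero_ne_one (hK : FourLeCardOrThreeEqZero K L) :
    ∃ k : K, k ≠ 0 ∧ k ≠ 1 := by
  obtain ⟨k, -, hk0, hk1, -⟩ | ⟨h3, -⟩ := hK
  · exact ⟨k, hk0, hk1⟩
  · refine ⟨-1, by simp, fun h1 => one_ne_zero (α := K) ?_⟩
    rw [neg_eq_iff_add_eq_zero, one_add_one_eq_two] at h1
    rw [← add_eq_left (a := (2 : K)), two_add_one_eq_three, h3, h1]

namespace AffineMorphism

variable {h : V →ₗ[K] K} {f : V → W} (hf : AffineMorphism L h f) {k : K}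
  (hr : ∀ y z : W, ∃ x, h x ≠ 0 ∧ f x ∉ span L {y, z})
include hf hr

theorem extend_add_mem (hk0 : k ≠ 0) (hk1 : k ≠ 1) {d : V → W}
    (hd : ∀ u, h u = 0 → IsDirection L h f u (d u)) {g : V → W}
    (hg0 : ∀ x, h x = 0 → g x = d x) (hg1 : ∀ x, h x ≠ 0 → g x = f x) (x y : V) :
    g (x + y) ∈ span L {g x, g y} := by
  by_cases hx : h x = 0 <;> by_cases hy : h y = 0
  · have hxy : h (x + y) = 0 := by simp [hx, hy]
    have hsub : IsDirection L h f (x - -y) (d (x + y)) := by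
      rw [sub_neg_eq_add]
      exact hd _ hxy
    rw [hg0 _ hx, hg0 _ hy, hg0 _ hxy]
    exact (hd x hx).sub_mem hf hk0 hk1 hr ((hd y hy).neg_left hf hy) hsub hx (by simp [hy])
  · rw [hg0 _ hx, hg1 _ hy, hg1 _ (by simp [hx, hy]), add_comm, Set.pair_comm]
    exact (hd x hx y hy).2
  · rw [hg1 _ hx, hg0 _ hy, hg1 _ (by simp [hx, hy])]
    exact (hd y hy x hx).2
  · rw [hg1 _ hx, hg1 _ hy]
    by_cases hxy : h (x + y) = 0
    · have hnx : h (-x) ≠ 0 := by simpa using hx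
      have hdir := (hd _ hxy (-x) hnx).1
      rw [neg_add_cancel_left] at hdir
      rw [hg0 _ hxy]
      exact mem_of_mem_span_pair hdir (mem_of_mem_span_singleton
        (hf.mem_singleton hnx hx (-1) (by simp)) (left_mem_span_pair _ _)) (right_mem_span_pair _ _)
    · rw [hg1 _ hxy]
      exact hf.mem_pair hxy hx hy 1 1 (by simp)

theorem extend_smul_mem {d : V → W} (hd : ∀ u, h u = 0 → IsDirection L h f u (d u)) {g : V → W}
    (hg0 : ∀ x, h x = 0 → g x = d x) (hg1 : ∀ x, h x ≠ 0 → g x = f x) (k : K) (x : V) :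
    g (k • x) ∈ span L {g x} := by
  obtain rfl | hk := eq_or_ne k 0
  · rw [zero_smul, hg0 _ (map_zero h)]
    have hd0 : IsDirection L h f 0 0 := fun a _ => by
      rw [add_zero]
      exact ⟨zero_mem _, left_mem_span_pair _ _⟩
    exact span_mono (Set.empty_subset _) <| by
      simpa using hd0.mem_span_singleton_of_isDirection hr (hd 0 (map_zero h))
  by_cases hx : h x = 0
  · have hkx : h (k • x) = 0 := by simp [hx]
    rw [hg0 _ hx, hg0 _ hkx]
    exact ((hd x hx).smul_left hf hx hk).mem_span_singleton_of_isDirection hr (hd _ hkx)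
  · have hkx : h (k • x) ≠ 0 := by simp [hx, hk]
    rw [hg1 _ hx, hg1 _ hkx]
    exact hf.mem_singleton hkx hx k rfl

theorem exists_semilinear_of_isDirection (hk0 : k ≠ 0) (hk1 : k ≠ 1)
    (hd : ∀ u, h u = 0 → ∃ p, IsDirection L h f u p) :
    ∃ (σ : K →+* L) (Φ : V →ₛₗ[σ] W), ∀ x, h x ≠ 0 → span L {f x} = span L {Φ x} := by
  classical
  choose! d hd using hd
  let g : V → W := fun x => if h x = 0 then d x else f x
  have hg0 : ∀ x, h x = 0 → g x = d x := fun x hx => if_pos hx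
  have hg1 : ∀ x, h x ≠ 0 → g x = f x := fun x hx => if_neg hx
  have hg : ProjectiveMorphism K L g :=
    ⟨hf.extend_add_mem hr hk0 hk1 hd hg0 hg1, hf.extend_smul_mem hr hd hg0 hg1⟩
  obtain ⟨σ, Φ, hΦ⟩ := hg.exists_semilinear fun y z => by
    obtain ⟨x, hx, hfx⟩ := hr y z
    exact ⟨x, by rwa [hg1 x hx]⟩
  exact ⟨σ, Φ, fun x hx => by rw [← hΦ, hg1 x hx]⟩

omit hr in
theorem isDirection_of_apply_eq_zero {e u : V} (he : h e ≠ 0) (hfe : f e = 0) (hu : h u = 0) :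
    IsDirection L h f u (f (e + u)) := fun a ha => by
  have heu : h (e + u) ≠ 0 := by simpa [hu] using he
  have hau : h (a + u) ≠ 0 := by simpa [hu] using ha
  constructor
  · have hmem := hf.mem_triple heu ha hau he (-1) 1 1 (by match_scalars <;> simp)
    exact mem_of_mem_span_triple hmem (left_mem_span_pair _ _) (right_mem_span_pair _ _)
      (hfe ▸ zero_mem _)
  · have hmem := hf.mem_triple hau ha heu he 1 1 (-1) (by match_scalars <;> simp)
    exact mem_of_mem_span_triple hmem (left_mem_span_pair _ _) (right_mem_span_pair _ _)
      (hfe ▸ zero_mem _)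

theorem exists_semilinear (hK : FourLeCardOrThreeEqZero K L) :
    ∃ (σ : K →+* L) (Φ : V →ₛₗ[σ] W), ∀ x, h x ≠ 0 → span L {f x} = span L {Φ x} := by
  obtain ⟨k, hk0, hk1⟩ := hK.exists_ne_zero_ne_one
  refine hf.exists_semilinear_of_isDirection hr hk0 hk1 fun u hu => ?_
  by_cases hne : ∀ x, h x ≠ 0 → f x ≠ 0
  · refine hf.exists_isDirection hne hk0 hk1 hr hu fun ha hb hc hiab hiac => ?_
    obtain ⟨α, β, hα0, hα1, hβ0, hβ1, hαβ⟩ | ⟨h3, h3'⟩ := hK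
    · exact hf.exists_mem_span_of_four_le hne hα0 hα1 hβ0 hβ1 hαβ ha hb hc hu hiab hiac
    · exact hf.exists_mem_span_of_three_eq_zero hne h3 h3' ha hb hc hu hiab hiac
  · push Not at hne
    obtain ⟨e, he, hfe⟩ := hne
    exact ⟨_, hf.isDirection_of_apply_eq_zero he hfe hu⟩

end AffineMorphism

end AffineFundamentalTheorem

section RepresentedFamilies

variable {ι K V L W U : Type*} [DivisionRing K] [AddCommGroup V] [Module K V]
  [DivisionRing L] [AddCommGroup W] [Module L W] [AddCommGroup U] [Module L U]
  {r : ι → V} {f : ι → W}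

/-- The map `⟨r i⟩ ↦ ⟨f i⟩` is a morphism from the geometry represented by the family `r` to the
geometry represented by the family `f`. The vector `f i` may vanish, which encodes a point at which
the map is undefined. -/
def SpanMorphism (K L : Type*) {ι V W : Type*} [DivisionRing K] [AddCommGroup V] [Module K V]
    [DivisionRing L] [AddCommGroup W] [Module L W] (r : ι → V) (f : ι → W) : Prop :=
  ∀ ⦃S : Set ι⦄ ⦃i : ι⦄, r i ∈ span K (r '' S) → f i ∈ span L (f '' S)

/-- The semilinear map `Φ` induces the map `⟨r i⟩ ↦ ⟨f i⟩` on the points of a represented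
family. -/
def Represents {σ : K →+* L} (Φ : V →ₛₗ[σ] W) (r : ι → V) (f : ι → W) : Prop :=
  ∀ i, span L {f i} = span L {Φ (r i)}

/-- The values of `f` are not contained in a subspace generated by `n` vectors. -/
def RankGT (L : Type*) {ι W : Type*} [DivisionRing L] [AddCommGroup W] [Module L W] (n : ℕ)
    (f : ι → W) : Prop :=
  ∀ s : Set W, s.encard ≤ n → ∃ i, f i ∉ span L s

/-- The points of the family `r` together with the hyperplane `ker h` cover the projective space:
the family is affino-projective. -/
structure CoversComplement (h : V →ₗ[K] K) (r : ι → V) : Prop where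
  ne_zero : h ≠ 0
  exists_span_eq : ∀ v, h v ≠ 0 → ∃ i, span K {r i} = span K {v}

theorem mkQ_mem_span_image {s t : Set V} {v : V} :
    (span K t).mkQ v ∈ span K ((span K t).mkQ '' s) ↔ v ∈ span K (t ∪ s) := by
  rw [← map_span, ← mem_comap, comap_map_mkQ, span_union]

theorem map_span_singleton_eq {σ : K →+* L} (Φ : V →ₛₗ[σ] W) {v w : V}
    (h : span K {v} = span K {w}) : span L {Φ v} = span L {Φ w} := by
  obtain ⟨hv, hw⟩ := span_singleton_eq_iff.1 h
  obtain ⟨a, ha⟩ := mem_span_singleton.1 hv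
  obtain ⟨b, hb⟩ := mem_span_singleton.1 hw
  refine span_singleton_eq_iff.2 ⟨?_, ?_⟩
  · rw [← ha, LinearMap.map_smulₛₗ]
    exact smul_mem_span_singleton _ _
  · rw [← hb, LinearMap.map_smulₛₗ]
    exact smul_mem_span_singleton _ _

namespace SpanMorphism

variable (hf : SpanMorphism K L r f)
include hf

theorem mem_pair {i a b : ι} (h : r i ∈ span K {r a, r b}) : f i ∈ span L {f a, f b} := by
  rw [← Set.image_pair] at h ⊢
  exact hf h

theorem mem_triple {i a b c : ι} (h : r i ∈ span K {r a, r b, r c}) :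
    f i ∈ span L {f a, f b, f c} := by
  rw [← Set.image_pair, ← Set.image_insert_eq] at h ⊢
  exact hf h

theorem mem_singleton {i a : ι} (h : r i ∈ span K {r a}) : f i ∈ span L {f a} := by
  rw [← Set.image_singleton] at h ⊢
  exact hf h

theorem span_eq {i j : ι} (h : span K {r i} = span K {r j}) : span L {f i} = span L {f j} :=
  span_singleton_eq_iff.2 <| (span_singleton_eq_iff.1 h).imp hf.mem_singleton hf.mem_singleton

theorem mkQ (i : ι) : SpanMorphism K L ((span K {r i}).mkQ ∘ r) ((span L {f i}).mkQ ∘ f) := by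
  intro S j hj
  rw [Set.image_comp] at hj ⊢
  refine mkQ_mem_span_image.2 ?_
  have hmem := mkQ_mem_span_image.1 hj
  rw [← Set.image_singleton, ← Set.image_union] at hmem ⊢
  exact hf hmem

end SpanMorphism

theorem RankGT.mkQ {m n : ℕ} (hf : RankGT L (m + n) f) {t : Set W} (ht : t.encard ≤ m) :
    RankGT L n ((span L t).mkQ ∘ f) := fun s hs => by
  have hinv := Function.rightInverse_surjInv (mkQ_surjective (span L t))
  obtain ⟨i, hi⟩ := hf (t ∪ Function.surjInv (mkQ_surjective (span L t)) '' s) <|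
    (Set.encard_union_le _ _).trans <| by
      push_cast
      exact add_le_add ht ((Set.encard_image_le _ _).trans hs)
  refine ⟨i, fun h => hi (mkQ_mem_span_image.1 ?_)⟩
  rwa [← Set.image_comp, hinv.id, Set.image_id]

theorem RankGT.exists_notMem_span_singleton (hf : RankGT L 1 f) (y : W) :
    ∃ i, f i ∉ span L {y} :=
  hf {y} (by rw [Set.encard_singleton, Nat.cast_one])

theorem RankGT.mono {m n : ℕ} (hf : RankGT L n f) (hmn : m ≤ n) : RankGT L m f :=
  fun s hs => hf s (hs.trans (by exact_mod_cast hmn))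

theorem encard_pair_le {α : Type*} (x y : α) : ({x, y} : Set α).encard ≤ 2 :=
  (Set.encard_insert_le _ _).trans_eq (by rw [Set.encard_singleton, one_add_one_eq_two])

theorem encard_triple_le {α : Type*} (x y z : α) : ({x, y, z} : Set α).encard ≤ 3 :=
  (Set.encard_insert_le _ _).trans <|
    (add_le_add_left (encard_pair_le y z) 1).trans_eq two_add_one_eq_three

theorem RankGT.exists_notMem_span_pair (hf : RankGT L 2 f) (y z : W) :
    ∃ i, f i ∉ span L {y, z} :=
  hf {y, z} (encard_pair_le y z)

theorem RankGT.exists_notMem_span_triple (hf : RankGT L 3 f) (x y z : W) :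
    ∃ i, f i ∉ span L {x, y, z} :=
  hf {x, y, z} (encard_triple_le x y z)

namespace Represents

variable {σ : K →+* L} {Φ : V →ₛₗ[σ] W} (hΦ : Represents Φ r f)
include hΦ

theorem comp (π : W →ₗ[L] U) : Represents (π ∘ₛₗ Φ) r (π ∘ f) :=
  fun i => map_span_singleton_eq π (hΦ i)

theorem apply_eq_zero {i : ι} (hi : f i = 0) : Φ (r i) = 0 := by
  have h0 := hΦ i
  rwa [hi, span_zero_singleton, eq_comm, span_singleton_eq_bot] at h0

theorem span_eq {i : ι} {v : V} (h : span K {r i} = span K {v}) :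
    span L {f i} = span L {Φ v} :=
  (hΦ i).trans (map_span_singleton_eq Φ h)

theorem exists_apply_notMem_span_singleton (hr : RankGT L 1 f) (y : W) :
    ∃ v, Φ v ∉ span L {y} := by
  obtain ⟨i, hi⟩ := hr.exists_notMem_span_singleton y
  exact ⟨r i, fun h => hi ((mem_iff_of_span_eq (hΦ i)).2 h)⟩

end Represents

theorem exists_semilinear_smul {σ : K →+* L} (Φ : V →ₛₗ[σ] W) {c : L} (hc : c ≠ 0) :
    ∃ (τ : K →+* L) (Ψ : V →ₛₗ[τ] W), ∀ v, Ψ v = c • Φ v := by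
  refine ⟨{ toFun := fun k => c * σ k * c⁻¹
            map_one' := by simp [hc]
            map_mul' := fun a b => by simp [mul_assoc, hc]
            map_zero' := by simp
            map_add' := fun a b => by simp [mul_add, add_mul] },
    { toFun := fun v => c • Φ v
      map_add' := fun a b => by simp
      map_smul' := fun k v => ?_ }, fun _ => rfl⟩
  change c • Φ (k • v) = (c * σ k * c⁻¹) • c • Φ v
  rw [LinearMap.map_smulₛₗ, smul_smul, smul_smul, inv_mul_cancel_right₀ hc]

end RepresentedFamilies

section CoversComplement

variable {ι K V L W : Type*} [DivisionRing K] [AddCommGroup V] [Module K V]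
  [DivisionRing L] [AddCommGroup W] [Module L W] {r : ι → V} {f : ι → W} {h : V →ₗ[K] K}

namespace SpanMorphism

variable (hf : SpanMorphism K L r f) {j : V → ι} (hj : ∀ v, h v ≠ 0 → span K {r (j v)} = span K {v})
include hf hj

theorem affineMorphism : AffineMorphism L h (f ∘ j) where
  mem_span x y z w hx hy hz hw hmem := by
    refine hf.mem_triple ?_
    rw [span_insert, span_insert, hj y hy, hj z hz, hj w hw, ← span_insert, ← span_insert]
    exact (mem_iff_of_span_eq (hj x hx)).2 hmem

theorem isDirection {i : ι} (hi : h (r i) = 0) : IsDirection L h (f ∘ j) (r i) (f i) :=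
  fun a ha => by
    have hai : h (a + r i) ≠ 0 := by simpa [hi] using ha
    constructor
    · refine hf.mem_pair ?_
      rw [span_pair_congr (hj a ha) (hj _ hai)]
      exact mem_span_pair.2 ⟨-1, 1, by match_scalars <;> simp⟩
    · refine hf.mem_pair ?_
      rw [span_pair_congr (hj a ha) rfl]
      exact (mem_iff_of_span_eq (hj _ hai)).2 (mem_span_pair.2 ⟨1, 1, by simp⟩)

theorem exists_apply_notMem (hh : h ≠ 0) (hr : RankGT L 2 f) (y z : W) :
    ∃ v, h v ≠ 0 ∧ (f ∘ j) v ∉ span L {y, z} := by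
  by_contra! hcon
  obtain ⟨i, hfi⟩ := hr.exists_notMem_span_pair y z
  refine hfi ?_
  by_cases hi : h (r i) = 0
  · obtain ⟨a, ha⟩ := DFunLike.ne_iff.1 hh
    have hai : h (a + r i) ≠ 0 := by simpa [hi] using ha
    exact mem_of_mem_span_pair (hf.isDirection hj hi a ha).1 (hcon _ ha) (hcon _ hai)
  · exact (mem_iff_of_span_eq (hf.span_eq (hj _ hi))).1 (hcon _ hi)

end SpanMorphism

theorem isDirection_of_span_eq {σ : K →+* L} {Φ : V →ₛₗ[σ] W} {F : V → W}
    (hΦ : ∀ v, h v ≠ 0 → span L {F v} = span L {Φ v}) {u : V} (hu : h u = 0) :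
    IsDirection L h F u (Φ u) := fun a ha => by
  have hau : h (a + u) ≠ 0 := by simpa [hu] using ha
  rw [span_pair_congr (hΦ a ha) (hΦ _ hau), span_pair_congr (hΦ a ha) rfl,
    mem_iff_of_span_eq (hΦ _ hau), map_add]
  exact ⟨mem_span_pair.2 ⟨-1, 1, by match_scalars <;> simp⟩, mem_span_pair.2 ⟨1, 1, by simp⟩⟩

theorem apply_sub_mem_span {σ τ : K →+* L} (Φ : V →ₛₗ[σ] W) (Ψ : V →ₛₗ[τ] W) {k : K}
    (hk0 : k ≠ 0) (hk1 : k ≠ 1) (hΨ : ∀ v, h v ≠ 0 → Ψ v ∈ span L {Φ v}) {a u : V} (ha : h a ≠ 0)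
    (hu : h u = h a) (hi : LinearIndependent L ![Φ a, Φ u]) :
    Ψ (u - a) ∈ span L {Φ (u - a)} := by
  have hu0 : h u ≠ 0 := by rwa [hu]
  have hσk : σ k ≠ 0 := (map_ne_zero σ).2 hk0
  have hna : h (-a) ≠ 0 := by simpa using ha
  have hku : h (k • u) ≠ 0 := by simpa [hk0] using hu0
  have ht : h (-a + k • u) ≠ 0 := by
    rw [map_add, map_neg, map_smul, hu, neg_add_eq_sub, smul_eq_mul, ← sub_one_mul]
    exact mul_ne_zero (sub_ne_zero.2 hk1) ha
  have hut : h (u + (-a + k • u)) ≠ 0 := by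
    rwa [map_add, map_add, map_neg, hu, add_neg_cancel_left]
  have hia : LinearIndependent L ![Φ (-a), Φ (k • u)] := by
    rw [linearIndependent_pair_iff_notMem] at hi ⊢
    rwa [map_neg, LinearMap.map_smulₛₗ, neg_ne_zero, ← Set.neg_singleton, span_neg,
      smul_mem_iff _ hσk]
  have hit : LinearIndependent L ![Φ u, Φ (-a + k • u)] := by
    rw [LinearIndependent.pair_symm_iff, linearIndependent_pair_iff_notMem] at hi
    rwa [linearIndependent_pair_iff_notMem, map_add, map_neg, LinearMap.map_smulₛₗ,
      add_mem_cancel_right (smul_mem_span_singleton _ _), neg_mem_iff]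
  obtain ⟨c, hca, hcu⟩ := exists_smul_of_add_mem_span hia (hΨ _ hna) (hΨ _ hku)
    (by simpa only [map_add] using hΨ _ ht)
  obtain ⟨d, hdu, hdt⟩ := exists_smul_of_add_mem_span hit (hΨ u hu0) (hΨ _ ht)
    (by simpa only [map_add] using hΨ _ hut)
  have hct : Ψ (-a + k • u) = c • Φ (-a + k • u) := by rw [map_add, map_add, smul_add, hca, hcu]
  obtain rfl : c = d := smul_left_injective L (hit.ne_zero 1) (hct.symm.trans hdt)
  rw [sub_eq_add_neg, map_add, map_add, hca, hdu, ← smul_add]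
  exact smul_mem_span_singleton _ _

theorem mem_span_of_forall_ne_zero {σ τ : K →+* L} (Φ : V →ₛₗ[σ] W) (Ψ : V →ₛₗ[τ] W) {k : K}
    (hk0 : k ≠ 0) (hk1 : k ≠ 1) (hh : h ≠ 0) (hr : ∀ y : W, ∃ v, Φ v ∉ span L {y})
    (hΨ : ∀ v, h v ≠ 0 → Ψ v ∈ span L {Φ v}) (v : V) : Ψ v ∈ span L {Φ v} := by
  obtain hv | hv := ne_or_eq (h v) 0
  · exact hΨ v hv
  have hadd : ∀ {a}, h a ≠ 0 → h (a + v) ≠ 0 := fun ha => by simpa [hv] using ha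
  have hr' : ∀ y : W, ∃ a, h a ≠ 0 ∧ Φ a ∉ span L {y} := by
    intro y
    by_contra! hcon
    obtain ⟨a, ha⟩ := DFunLike.ne_iff.1 hh
    obtain ⟨w, hw⟩ := hr y
    by_cases hhw : h w = 0
    · have haw := hcon (a + w) (by simpa [hhw] using ha)
      exact hw (by rwa [map_add, add_mem_cancel_left (hcon a ha)] at haw)
    · exact hw (hcon w hhw)
  by_cases hΦv : Φ v = 0
  · obtain ⟨a, ha, hΦa⟩ := hr' (Ψ v)
    have hmem := hΨ _ (hadd ha)
    rw [map_add, map_add, hΦv, add_zero, add_mem_cancel_left (hΨ a ha)] at hmem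
    rw [show Ψ v = 0 from of_not_not fun h0 => hΦa (mem_span_singleton_symm hmem h0)]
    exact zero_mem _
  · obtain ⟨a, ha, hΦa⟩ := hr' (Φ v)
    have hsub := apply_sub_mem_span Φ Ψ hk0 hk1 hΨ ha (u := a + v) (by simp [hv])
      (linearIndependent_pair_iff_notMem.2 ⟨fun h0 => hΦa (h0 ▸ zero_mem _), fun hmem => hΦa ?_⟩)
    · rwa [add_sub_cancel_left] at hsub
    · rw [map_add, add_mem_cancel_left (mem_span_singleton_self _)] at hmem
      exact mem_span_singleton_symm hmem hΦv

namespace CoversComplement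

variable (hX : CoversComplement h r)
include hX

theorem exists_represents (hf : SpanMorphism K L r f) (hr : RankGT L 2 f)
    (hK : FourLeCardOrThreeEqZero K L) :
    ∃ (σ : K →+* L) (Φ : V →ₛₗ[σ] W), Represents Φ r f := by
  have : Nonempty ι := ⟨(hr.exists_notMem_span_pair 0 0).choose⟩
  choose! j hj using hX.exists_span_eq
  have hF := hf.affineMorphism hj
  have hrF := hf.exists_apply_notMem hj hX.ne_zero hr
  obtain ⟨σ, Φ, hΦ⟩ := hF.exists_semilinear hrF hK
  refine ⟨σ, Φ, fun i => ?_⟩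
  by_cases hi : h (r i) = 0
  · have hfi := hf.isDirection hj hi
    have hΦi := isDirection_of_span_eq hΦ hi
    exact span_singleton_eq_iff.2 ⟨hΦi.mem_span_singleton_of_isDirection hrF hfi,
      hfi.mem_span_singleton_of_isDirection hrF hΦi⟩
  · rw [← hΦ _ hi]
    exact hf.span_eq (hj _ hi).symm

theorem exists_eq_smul {k : K} (hk0 : k ≠ 0) (hk1 : k ≠ 1) {σ τ : K →+* L} {Φ : V →ₛₗ[σ] W}
    {Ψ : V →ₛₗ[τ] W} (hΦ : Represents Φ r f) (hΨ : Represents Ψ r f) (hr : RankGT L 1 f) :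
    ∃ c : L, ∀ v, Ψ v = c • Φ v := by
  have hrΦ := hΦ.exists_apply_notMem_span_singleton hr
  refine exists_eq_smul_of_mem_span Φ.toAddMonoidHom Ψ.toAddMonoidHom hrΦ ?_
  refine mem_span_of_forall_ne_zero Φ Ψ hk0 hk1 hX.ne_zero hrΦ fun v hv => ?_
  obtain ⟨i, hi⟩ := hX.exists_span_eq v hv
  rw [← hΦ.span_eq hi, hΨ.span_eq hi]
  exact mem_span_singleton_self _

end CoversComplement

end CoversComplement

section ProjectionFromPoints

variable {ι K V L W : Type*} [DivisionRing K] [AddCommGroup V] [Module K V]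
  [DivisionRing L] [AddCommGroup W] [Module L W] {r : ι → V} {f : ι → W} {σ τ : K →+* L}

theorem Represents.smul {Φ : V →ₛₗ[σ] W} {Ψ : V →ₛₗ[τ] W} (hΦ : Represents Φ r f) {c : L}
    (hc : c ≠ 0) (hΨ : ∀ v, Ψ v = c • Φ v) : Represents Ψ r f := fun i => by
  rw [hΨ, span_singleton_smul_eq hc.isUnit]
  exact hΦ i

theorem mem_sup_of_span_mkQ_eq {N : Submodule L W} {x y : W}
    (h : span L {N.mkQ x} = span L {N.mkQ y}) : x ∈ N ⊔ span L {y} := by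
  rw [← comap_map_mkQ, map_span, Set.image_singleton, ← h]
  exact mem_span_singleton_self _

theorem ringHom_eq_of_forall_eq {Φ : V →ₛₗ[σ] W} {Ψ : V →ₛₗ[τ] W} (h : ∀ v, Φ v = Ψ v) {v : V}
    (hv : Φ v ≠ 0) : σ = τ := by
  ext k
  have hk := h (k • v)
  rw [LinearMap.map_smulₛₗ, LinearMap.map_smulₛₗ, ← h v] at hk
  exact smul_left_injective L hv hk

theorem eq_of_mkQ_eq_mkQ {N₁ N₂ : Submodule L W} (hN : Disjoint N₁ N₂) {x y : W}
    (h₁ : N₁.mkQ x = N₁.mkQ y) (h₂ : N₂.mkQ x = N₂.mkQ y) : x = y := by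
  rw [← sub_eq_zero]
  exact disjoint_def.1 hN _ ((Submodule.Quotient.eq N₁).1 h₁) ((Submodule.Quotient.eq N₂).1 h₂)

theorem exists_mkQ_eq_mkQ_eq {N₁ N₂ : Submodule L W} {y₁ : W ⧸ N₁} {y₂ : W ⧸ N₂}
    (h : factor (le_sup_left : N₁ ≤ N₁ ⊔ N₂) y₁ = factor le_sup_right y₂) :
    ∃ x, N₁.mkQ x = y₁ ∧ N₂.mkQ x = y₂ := by
  obtain ⟨x₁, rfl⟩ := N₁.mkQ_surjective y₁
  obtain ⟨x₂, rfl⟩ := N₂.mkQ_surjective y₂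
  obtain ⟨n₁, hn₁, n₂, hn₂, hn⟩ := mem_sup.1 ((Submodule.Quotient.eq _).1 h)
  rw [LinearMap.id_apply, LinearMap.id_apply] at hn
  refine ⟨x₁ - n₁, (Submodule.Quotient.eq _).2 ?_, (Submodule.Quotient.eq _).2 ?_⟩
  · simpa using hn₁
  · rwa [sub_right_comm, ← hn, add_sub_cancel_left]

theorem exists_semilinear_mkQ_eq {N₁ N₂ : Submodule L W} (hN : Disjoint N₁ N₂)
    {Φ₁ : V →ₛₗ[σ] W ⧸ N₁} {Φ₂ : V →ₛₗ[σ] W ⧸ N₂}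
    (h : ∀ v, factor (le_sup_left : N₁ ≤ N₁ ⊔ N₂) (Φ₁ v) = factor le_sup_right (Φ₂ v)) :
    ∃ Φ : V →ₛₗ[σ] W, N₁.mkQ ∘ₛₗ Φ = Φ₁ ∧ N₂.mkQ ∘ₛₗ Φ = Φ₂ := by
  choose Φ hΦ₁ hΦ₂ using fun v => exists_mkQ_eq_mkQ_eq (h v)
  exact ⟨{ toFun := Φ
           map_add' := fun v w => eq_of_mkQ_eq_mkQ hN
            (by simp only [map_add, hΦ₁]) (by simp only [map_add, hΦ₂])
           map_smul' := fun a v => eq_of_mkQ_eq_mkQ hN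
            (by simp only [map_smul, LinearMap.map_smulₛₗ, hΦ₁])
            (by simp only [map_smul, LinearMap.map_smulₛₗ, hΦ₂]) },
    LinearMap.ext hΦ₁, LinearMap.ext hΦ₂⟩

namespace CoversComplement

variable {i : ι} {h : V ⧸ span K {r i} →ₗ[K] K}
  (hX : CoversComplement h ((span K {r i}).mkQ ∘ r)) {k : K}
include hX

theorem exists_represents_mkQ (hf : SpanMorphism K L r f) (hr : RankGT L 3 f)
    (hK : FourLeCardOrThreeEqZero K L) :
    ∃ (σ : K →+* L) (Φ : V →ₛₗ[σ] W ⧸ span L {f i}), Represents Φ r ((span L {f i}).mkQ ∘ f) := by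
  obtain ⟨σ, Φ, hΦ⟩ := hX.exists_represents (hf.mkQ i)
    (RankGT.mkQ (m := 1) hr (Set.encard_singleton _).le) hK
  exact ⟨σ, Φ ∘ₛₗ (span K {r i}).mkQ, hΦ⟩

theorem exists_eq_smul_of_apply_eq_zero (hk0 : k ≠ 0) (hk1 : k ≠ 1) (hi : f i = 0)
    {Φ : V →ₛₗ[σ] W} {Ψ : V →ₛₗ[τ] W} (hΦ : Represents Φ r f) (hΨ : Represents Ψ r f)
    (hr : RankGT L 1 f) : ∃ c : L, ∀ v, Ψ v = c • Φ v := by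
  have hΦi := (span_singleton_le_iff_mem _ _).2 (LinearMap.mem_ker.2 (hΦ.apply_eq_zero hi))
  have hΨi := (span_singleton_le_iff_mem _ _).2 (LinearMap.mem_ker.2 (hΨ.apply_eq_zero hi))
  obtain ⟨c, hc⟩ := hX.exists_eq_smul hk0 hk1 (Φ := liftQ _ Φ hΦi) (Ψ := liftQ _ Ψ hΨi) hΦ hΨ hr
  exact ⟨c, fun v => hc ((span K {r i}).mkQ v)⟩

theorem exists_sub_smul_mem (hk0 : k ≠ 0) (hk1 : k ≠ 1)
    {Φ : V →ₛₗ[σ] W} {Ψ : V →ₛₗ[τ] W} (hΦ : Represents Φ r f) (hΨ : Represents Ψ r f)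
    (hr : RankGT L 2 f) : ∃ c : L, ∀ v, Ψ v - c • Φ v ∈ span L {f i} := by
  obtain ⟨c, hc⟩ := hX.exists_eq_smul_of_apply_eq_zero hk0 hk1
    (by simp) (hΦ.comp (span L {f i}).mkQ) (hΨ.comp _)
    (RankGT.mkQ (m := 1) hr (Set.encard_singleton _).le)
  exact ⟨c, fun v => (Submodule.Quotient.eq _).1 (hc v)⟩

end CoversComplement

variable {i₁ i₂ : ι} {h₁ : V ⧸ span K {r i₁} →ₗ[K] K} {h₂ : V ⧸ span K {r i₂} →ₗ[K] K} {k : K}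

theorem Represents.exists_eq_smul {Φ : V →ₛₗ[σ] W} {Ψ : V →ₛₗ[τ] W} (hΦ : Represents Φ r f)
    (hΨ : Represents Ψ r f) (hr : RankGT L 2 f)
    (hX₁ : CoversComplement h₁ ((span K {r i₁}).mkQ ∘ r))
    (hX₂ : CoversComplement h₂ ((span K {r i₂}).mkQ ∘ r))
    (hd : Disjoint (span L {f i₁}) (span L {f i₂})) (hk0 : k ≠ 0) (hk1 : k ≠ 1) :
    ∃ c : L, ∀ v, Ψ v = c • Φ v := by
  obtain ⟨c, hc⟩ := hX₁.exists_sub_smul_mem hk0 hk1 hΦ hΨ hr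
  obtain ⟨d, hd'⟩ := hX₂.exists_sub_smul_mem hk0 hk1 hΦ hΨ hr
  obtain ⟨j, hj⟩ := hr.exists_notMem_span_pair (f i₁) (f i₂)
  have hcd : d - c = 0 := by
    by_contra hne
    have hsub : (d - c) • Φ (r j) = (Ψ (r j) - c • Φ (r j)) - (Ψ (r j) - d • Φ (r j)) := by
      rw [sub_sub_sub_cancel_left, sub_smul]
    refine hj ((mem_iff_of_span_eq (hΦ j)).2 ((smul_mem_iff _ hne).1 (hsub ▸ sub_mem ?_ ?_)))
    · exact mem_of_mem_span_singleton (hc _) (left_mem_span_pair _ _)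
    · exact mem_of_mem_span_singleton (hd' _) (right_mem_span_pair _ _)
  obtain rfl := sub_eq_zero.1 hcd
  exact ⟨d, fun v => sub_eq_zero.1 (disjoint_def.1 hd _ (hc v) (hd' v))⟩

theorem exists_semilinear_represents_mkQ {N₁ N₂ : Submodule L W} (hN : Disjoint N₁ N₂)
    {Φ₁ : V →ₛₗ[σ] W ⧸ N₁} {Φ₂ : V →ₛₗ[τ] W ⧸ N₂} (hΦ₁ : Represents Φ₁ r (N₁.mkQ ∘ f))
    (hΦ₂ : Represents Φ₂ r (N₂.mkQ ∘ f)) {c : L}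
    (h : ∀ v, factor le_sup_right (Φ₂ v) = c • factor (le_sup_left : N₁ ≤ N₁ ⊔ N₂) (Φ₁ v)) {v : V}
    (hv : factor (le_sup_right : N₂ ≤ N₁ ⊔ N₂) (Φ₂ v) ≠ 0) :
    ∃ Φ : V →ₛₗ[τ] W, Represents (N₁.mkQ ∘ₛₗ Φ) r (N₁.mkQ ∘ f) ∧
      Represents (N₂.mkQ ∘ₛₗ Φ) r (N₂.mkQ ∘ f) := by
  have hc : c ≠ 0 := by
    rintro rfl
    exact hv (by rw [h, zero_smul])
  obtain ⟨ρ, Ψ, hΨ⟩ := exists_semilinear_smul Φ₁ hc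
  have hΨΦ : ∀ v, (factor (le_sup_right : N₂ ≤ N₁ ⊔ N₂) ∘ₛₗ Φ₂) v =
      (factor (le_sup_left : N₁ ≤ N₁ ⊔ N₂) ∘ₛₗ Ψ) v := fun v => by
    rw [LinearMap.comp_apply, LinearMap.comp_apply, h, hΨ, map_smul]
  obtain rfl := ringHom_eq_of_forall_eq hΨΦ hv
  obtain ⟨Φ, rfl, rfl⟩ := exists_semilinear_mkQ_eq hN fun v => (hΨΦ v).symm
  exact ⟨Φ, hΦ₁.smul hc hΨ, hΦ₂⟩

theorem SpanMorphism.exists_represents_mkQ_mkQ (hf : SpanMorphism K L r f)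
    (hX₁ : CoversComplement h₁ ((span K {r i₁}).mkQ ∘ r))
    (hX₂ : CoversComplement h₂ ((span K {r i₂}).mkQ ∘ r))
    (hd : Disjoint (span L {f i₁}) (span L {f i₂})) (hk0 : k ≠ 0) (hk1 : k ≠ 1)
    (hr : RankGT L 3 f)
    (hK : FourLeCardOrThreeEqZero K L) :
    ∃ (σ : K →+* L) (Φ : V →ₛₗ[σ] W),
      Represents ((span L {f i₁}).mkQ ∘ₛₗ Φ) r ((span L {f i₁}).mkQ ∘ f) ∧
      Represents ((span L {f i₂}).mkQ ∘ₛₗ Φ) r ((span L {f i₂}).mkQ ∘ f) := by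
  obtain ⟨σ₁, Φ₁, hΦ₁⟩ := hX₁.exists_represents_mkQ hf hr hK
  obtain ⟨σ₂, Φ₂, hΦ₂⟩ := hX₂.exists_represents_mkQ hf hr hK
  have hπ₁ := hΦ₁.comp (factor (le_sup_left : _ ≤ span L {f i₁} ⊔ span L {f i₂}))
  have hπ₂ := hΦ₂.comp (factor (le_sup_right : _ ≤ span L {f i₁} ⊔ span L {f i₂}))
  have hr' : RankGT L 1 ((span L {f i₁} ⊔ span L {f i₂}).mkQ ∘ f) := by
    rw [← span_insert]
    exact RankGT.mkQ (m := 2) hr (encard_pair_le _ _)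
  have hi₁ : ((span L {f i₁} ⊔ span L {f i₂}).mkQ ∘ f) i₁ = 0 :=
    (Submodule.Quotient.mk_eq_zero _).2 (mem_sup_left (mem_span_singleton_self _))
  obtain ⟨c, hc⟩ := hX₁.exists_eq_smul_of_apply_eq_zero hk0 hk1 hi₁ hπ₁ hπ₂ hr'
  obtain ⟨v, hv⟩ := hπ₂.exists_apply_notMem_span_singleton hr' 0
  rw [span_zero_singleton, mem_bot] at hv
  exact ⟨σ₂, exists_semilinear_represents_mkQ hd hΦ₁ hΦ₂ hc hv⟩

section EnoughPoints

variable {M N₁ N₂ : Submodule L W} {x y z u : W}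

theorem mem_span_singleton_of_mem_sup (hN : Disjoint N₁ N₂) (hx : x ∉ N₁ ⊔ N₂)
    (h₁ : y ∈ N₁ ⊔ span L {x}) (h₂ : y ∈ N₂ ⊔ span L {x}) : y ∈ span L {x} := by
  obtain ⟨n₁, hn₁, _, hm₁, rfl⟩ := mem_sup.1 h₁
  obtain ⟨n₂, hn₂, _, hm₂, hn⟩ := mem_sup.1 h₂
  obtain ⟨a, rfl⟩ := mem_span_singleton.1 hm₁
  obtain ⟨b, rfl⟩ := mem_span_singleton.1 hm₂
  have hba : (b - a) • x = n₁ - n₂ := by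
    rw [sub_smul, sub_eq_sub_iff_add_eq_add, add_comm, hn]
  obtain rfl : b = a := by
    by_contra hne
    refine hx ((smul_mem_iff _ (sub_ne_zero.2 hne)).1 (hba ▸ sub_mem ?_ ?_))
    exacts [mem_sup_left hn₁, mem_sup_right hn₂]
  obtain rfl := add_right_cancel hn
  rwa [disjoint_def.1 hN n₂ hn₁ hn₂, zero_add]

theorem mem_span_singleton_of_mem_span_triple (hu : u ∈ span L {x, y, z}) (huM : u ∈ M)
    (hx : x ∈ M) (hy : y ∉ M) (hz : z ∉ M ⊔ span L {y}) : u ∈ span L {x} := by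
  obtain ⟨a, b, c, rfl⟩ := mem_span_triple.1 hu
  have hc : c = 0 := by
    by_contra hc
    refine hz ((smul_mem_iff _ hc).1 ?_)
    rw [← add_mem_cancel_left (x := a • x + b • y)]
    · exact mem_sup_left huM
    · exact add_mem (mem_sup_left (smul_mem _ _ hx)) (mem_sup_right (smul_mem_span_singleton _ _))
  have hb : b = 0 := by
    by_contra hb
    refine hy ((smul_mem_iff _ hb).1 ?_)
    rw [hc, zero_smul, add_zero] at huM
    rwa [add_mem_cancel_left (smul_mem _ _ hx)] at huM
  rw [hb, hc, zero_smul, zero_smul, add_zero, add_zero]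
  exact smul_mem_span_singleton _ _

/-- Every point of a plane of the geometry represented by `r` lies in the span of other points of
that plane. This is how the existence of a quadrangle in each plane is used. -/
def PlanesRedundant (K : Type*) {ι V : Type*} [DivisionRing K] [AddCommGroup V] [Module K V]
    (r : ι → V) : Prop :=
  ∀ ⦃i p q⦄, LinearIndependent K ![r i, r p, r q] →
    ∃ S : Set ι, r i ∈ span K (r '' S) ∧
      ∀ j ∈ S, r j ∈ span K {r i, r p, r q} ∧ r j ∉ span K {r i}

theorem SpanMorphism.linearIndependent_triple (hf : SpanMorphism K L r f) {i p q : ι}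
    (h : LinearIndependent L ![f i, f p, f q]) : LinearIndependent K ![r i, r p, r q] := by
  obtain ⟨hi, hp, hq⟩ := linearIndependent_triple_iff_notMem.1 h
  refine linearIndependent_triple_iff_notMem.2
    ⟨fun h0 => hi ?_, fun hmem => hp (hf.mem_singleton hmem), fun hmem => hq (hf.mem_pair hmem)⟩
  simpa using hf (S := ∅) (h0 ▸ zero_mem _)

theorem SpanMorphism.apply_notMem (hf : SpanMorphism K L r f) {i p q j : ι} (hi : f i ∈ M)
    (hp : f p ∉ M) (hq : f q ∉ M ⊔ span L {f p}) (hj : r j ∈ span K {r i, r p, r q})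
    (hji : r j ∉ span K {r i}) : f j ∉ M := fun hjM => by
  by_cases hjp : r j ∈ span K {r i, r p}
  · exact hp (mem_of_mem_span_pair (hf.mem_pair (mem_span_pair_exchange' hjp hji)) hi hjM)
  · rw [Set.pair_comm (r p), Set.insert_comm] at hj
    have hqj : r q ∈ span K {r j, r i, r p} := mem_span_insert_exchange hj hjp
    exact hq (mem_of_mem_span_triple (hf.mem_triple hqj) (mem_sup_left hjM) (mem_sup_left hi)
      (mem_sup_right (mem_span_singleton_self _)))

theorem SpanMorphism.apply_mem_span_of_mem (hf : SpanMorphism K L r f) (hf0 : ∀ j, f j ≠ 0)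
    (hE : PlanesRedundant K r) {Φ : V →ₛₗ[σ] W} (hΦ : ∀ j, f j ∉ M → Φ (r j) ∈ span L {f j})
    {i p q : ι} (hΦi : Φ (r i) ∈ M) (hi : f i ∈ M) (hp : f p ∉ M) (hq : f q ∉ M ⊔ span L {f p}) :
    Φ (r i) ∈ span L {f i} := by
  have hindep : LinearIndependent L ![f i, f p, f q] := by
    refine linearIndependent_triple_iff_notMem.2 ⟨hf0 i, fun h => ?_, fun h => ?_⟩
    · exact hp (mem_of_mem_span_singleton h hi)
    · exact hq (mem_of_mem_span_pair h (mem_sup_left hi)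
        (mem_sup_right (mem_span_singleton_self _)))
  obtain ⟨S, hS, hSj⟩ := hE (hf.linearIndependent_triple hindep)
  have hle : span K (r '' S) ≤ (span L {f i, f p, f q}).comap Φ := by
    refine span_le.2 ?_
    rintro _ ⟨j, hj, rfl⟩
    have hjM := hf.apply_notMem hi hp hq (hSj j hj).1 (hSj j hj).2
    exact mem_comap.2 (mem_of_mem_span_singleton (hΦ j hjM) (hf.mem_triple (hSj j hj).1))
  exact mem_span_singleton_of_mem_span_triple (hle hS) hΦi hi hp hq

theorem SpanMorphism.represents_of_mkQ (hf : SpanMorphism K L r f) (hf0 : ∀ j, f j ≠ 0)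
    (hE : PlanesRedundant K r) {Φ : V →ₛₗ[σ] W} {i₁ i₂ : ι}
    (hd : Disjoint (span L {f i₁}) (span L {f i₂})) (hr : RankGT L 3 f)
    (hΦ₁ : Represents ((span L {f i₁}).mkQ ∘ₛₗ Φ) r ((span L {f i₁}).mkQ ∘ f))
    (hΦ₂ : Represents ((span L {f i₂}).mkQ ∘ₛₗ Φ) r ((span L {f i₂}).mkQ ∘ f)) :
    Represents Φ r f := fun i => by
  have hle₁ : span L {f i₁} ≤ span L {f i₁} ⊔ span L {f i₂} := le_sup_left
  have h₁ := fun j => mem_sup_of_span_mkQ_eq (hΦ₁ j).symm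
  have h₂ := fun j => mem_sup_of_span_mkQ_eq (hΦ₂ j).symm
  have hΦi0 : Φ (r i) ≠ 0 := fun h0 => hf0 i <| disjoint_def.1 hd _
    (by simpa [h0] using mem_sup_of_span_mkQ_eq (hΦ₁ i))
    (by simpa [h0] using mem_sup_of_span_mkQ_eq (hΦ₂ i))
  have hoff : ∀ j, f j ∉ span L {f i₁} ⊔ span L {f i₂} → Φ (r j) ∈ span L {f j} := fun j hj =>
    mem_span_singleton_of_mem_sup hd hj (h₁ j) (h₂ j)
  refine (span_singleton_eq_of_mem ?_ hΦi0).symm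
  by_cases hi : f i ∈ span L {f i₁} ⊔ span L {f i₂}
  · have hΦi : Φ (r i) ∈ span L {f i₁} ⊔ span L {f i₂} :=
      sup_le hle₁ ((span_singleton_le_iff_mem _ _).2 hi) (h₁ i)
    obtain ⟨p, hp⟩ := (hr.mono (m := 2) (by simp)).exists_notMem_span_pair (f i₁) (f i₂)
    obtain ⟨q, hq⟩ := hr.exists_notMem_span_triple (f i₁) (f i₂) (f p)
    rw [span_insert] at hp
    rw [span_insert, span_insert, ← sup_assoc] at hq
    exact hf.apply_mem_span_of_mem hf0 hE hoff hΦi hi hp hq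
  · exact hoff i hi

theorem SpanMorphism.exists_represents (hf : SpanMorphism K L r f) (hf0 : ∀ j, f j ≠ 0)
    (hE : PlanesRedundant K r) {i₁ i₂ : ι} {h₁ : V ⧸ span K {r i₁} →ₗ[K] K}
    {h₂ : V ⧸ span K {r i₂} →ₗ[K] K} (hX₁ : CoversComplement h₁ ((span K {r i₁}).mkQ ∘ r))
    (hX₂ : CoversComplement h₂ ((span K {r i₂}).mkQ ∘ r))
    (hd : Disjoint (span L {f i₁}) (span L {f i₂})) (hr : RankGT L 3 f)
    (hK : FourLeCardOrThreeEqZero K L) :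
    ∃ (σ : K →+* L) (Φ : V →ₛₗ[σ] W), Represents Φ r f := by
  obtain ⟨k, hk0, hk1⟩ := hK.exists_ne_zero_ne_one
  obtain ⟨σ, Φ, hΦ₁, hΦ₂⟩ := hf.exists_represents_mkQ_mkQ hX₁ hX₂ hd hk0 hk1 hr hK
  exact ⟨σ, Φ, hf.represents_of_mkQ hf0 hE hd hr hΦ₁ hΦ₂⟩

end EnoughPoints

end ProjectionFromPoints

section Cardinality

variable {K L : Type*} [DivisionRing K] [DivisionRing L]

theorem exists_notMem_of_encard_lt {α : Type*} {s : Set α} (h : s.encard < ENat.card α) :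
    ∃ x, x ∉ s := by
  by_contra! hs
  rw [Set.eq_univ_of_forall hs, Set.encard_univ] at h
  exact h.ne rfl

theorem three_eq_zero_of_card (h : ENat.card K = 3) : (3 : K) = 0 := by
  have hcard : Nat.card K = 3 := by
    rw [← Set.ncard_univ, Set.ncard_def, Set.encard_univ, h]
    rfl
  have hnsmul := card_nsmul_eq_zero' (x := (1 : K))
  rwa [hcard, nsmul_one, Nat.cast_ofNat] at hnsmul

theorem three_eq_zero_of_ringChar (h : ringChar L = 3) : (3 : L) = 0 := by
  have hcast := ringChar.Nat.cast_ringChar (R := L)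
  rwa [h, Nat.cast_ofNat] at hcast

theorem fourLeCardOrThreeEqZero_of_card
    (h : 4 ≤ ENat.card K ∨ (ENat.card K = 3 ∧ ringChar L = 3)) : FourLeCardOrThreeEqZero K L := by
  refine h.imp (fun h4 => ?_) (.imp three_eq_zero_of_card three_eq_zero_of_ringChar)
  have hlt : (3 : ℕ∞) < ENat.card K := lt_of_lt_of_le (by norm_num) h4
  obtain ⟨α, hα⟩ := exists_notMem_of_encard_lt ((encard_triple_le (0 : K) 1 1).trans_lt hlt)
  obtain ⟨β, hβ⟩ := exists_notMem_of_encard_lt ((encard_triple_le 0 1 α).trans_lt hlt)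
  simp only [Set.mem_insert_iff, Set.mem_singleton_iff, not_or] at hα hβ
  exact ⟨α, β, hα.1, hα.2.1, hβ.1, hβ.2.1, Ne.symm hβ.2.2⟩

theorem encard_le_of_span_le {V : Type*} [AddCommGroup V] [Module K V] {b s : Set V}
    (hb : LinearIndepOn K id b) (h : span K b ≤ span K s) : b.encard ≤ s.encard := by
  have hrank : Cardinal.mk b ≤ Cardinal.mk s :=
    (rank_span_set hb).symm.trans_le ((Submodule.rank_mono h).trans (rank_span_le s))
  rw [← Set.toENat_cardinalMk, ← Set.toENat_cardinalMk]
  exact Cardinal.toENat.monotone' hrank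

end Cardinality

section RepresentedGeometries

variable {ι κ K V L W : Type*} [DivisionRing K] [AddCommGroup V] [Module K V]
  [DivisionRing L] [AddCommGroup W] [Module L W] {G : Geometry ι} {r : ι → V}

namespace Geometry

theorem isMorphism_apply_mem_closure {G' : Geometry κ} {φ : ι → κ} (hφ : G.IsMorphism G' φ)
    {S : Set ι} {i : ι} (hi : i ∈ G.closure S) : φ i ∈ G'.closure (φ '' S) :=
  G.closure_subset (hφ _ (G'.isFlat_closure _))
    (Set.image_subset_iff.1 (G'.subset_closure _)) hi

/-- The family of vectors `r` represents the geometry `G` over `K`: the closure operator of `G`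
is induced by linear spans. -/
def IsRepresentedBy (G : Geometry ι) (K : Type*) {V : Type*} [DivisionRing K] [AddCommGroup V]
    [Module K V] (r : ι → V) : Prop :=
  ∀ ⦃A : Set ι⦄ ⦃i : ι⦄, i ∈ G.closure A ↔ r i ∈ span K (r '' A)

theorem isRepresentedBy_rep : (projGeometry K V).IsRepresentedBy K Projectivization.rep :=
  fun A _ => Set.ext_iff.1 (flatClosure_proj A) _

namespace IsRepresentedBy

variable (hG : G.IsRepresentedBy K r)
include hG

theorem sub (X : Set ι) : (G.sub X).IsRepresentedBy K (r ∘ ((↑) : X → ι)) := fun A i => by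
  change i ∈ flatClosure (G.SubIsFlat X) A ↔ r i.1 ∈ span K _
  rw [flatClosure_sub, Set.image_comp, ← hG, Set.mem_preimage]

theorem eq_of_mem_span_singleton {i j : ι} (h : r i ∈ span K {r j}) : i = j := by
  rwa [← Set.image_singleton, ← hG, G.closure_eq (G.isFlat_singleton j)] at h

theorem ne_zero (i : ι) : r i ≠ 0 := fun h => by
  have hmem : i ∈ G.closure ∅ := hG.2 (h ▸ zero_mem _)
  rwa [G.closure_eq G.isFlat_empty] at hmem

theorem disjoint_span_singleton {i j : ι} (h : i ≠ j) : Disjoint (span K {r i}) (span K {r j}) :=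
  disjoint_span_singleton_of_notMem fun hj => h (hG.eq_of_mem_span_singleton hj).symm

theorem span_image_eq_of_closure_eq {A B : Set ι} (h : G.closure A = G.closure B) :
    span K (r '' A) = span K (r '' B) := by
  have hle : ∀ {A B : Set ι}, G.closure A = G.closure B → span K (r '' A) ≤ span K (r '' B) := by
    intro A B h
    refine span_le.2 (Set.image_subset_iff.2 fun i hi => hG.1 ?_)
    rw [← h]
    exact G.subset_closure A hi
  exact (hle h).antisymm (hle h.symm)

theorem independent_range {w : κ → ι} (hw : LinearIndependent K (r ∘ w)) :
    G.Independent (Set.range w) := by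
  rintro _ ⟨k, rfl⟩ hk
  refine linearIndependent_iff_notMem_span.1 hw k (span_mono ?_ (hG.1 hk))
  rintro _ ⟨_, ⟨⟨l, rfl⟩, hl⟩, rfl⟩
  exact ⟨l, ⟨trivial, fun hlk => hl (congrArg w hlk)⟩, rfl⟩

theorem hasDim_closure_range {w : κ → ι} (hw : LinearIndependent K (r ∘ w)) {n : ℕ}
    (hn : ENat.card κ = n + 1) : G.HasDim (G.closure (Set.range w)) n := by
  refine ⟨_, ⟨hG.independent_range hw, rfl⟩, ?_⟩
  rw [← Set.image_univ, hw.injective.of_comp.encard_image, Set.encard_univ, hn]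

theorem isLine_closure_pair {i j : ι} (h : LinearIndependent K ![r i, r j]) :
    G.IsLine (G.closure {i, j}) := by
  rw [← Matrix.range_cons_cons_empty i j ![]]
  have hcomp : r ∘ ![i, j] = ![r i, r j] := by
    ext k
    fin_cases k <;> rfl
  exact hG.hasDim_closure_range (hcomp ▸ h) <| by
    rw [ENat.card_eq_coe_fintype_card, Fintype.card_fin]
    rfl

theorem isPlane_closure_triple {i j k : ι} (h : LinearIndependent K ![r i, r j, r k]) :
    G.IsPlane (G.closure {i, j, k}) := by
  rw [← range_triple]
  have hcomp : r ∘ ![i, j, k] = ![r i, r j, r k] := by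
    ext l
    fin_cases l <;> rfl
  exact hG.hasDim_closure_range (hcomp ▸ h) <| by
    rw [ENat.card_eq_coe_fintype_card, Fintype.card_fin]
    rfl

theorem linearIndependent_of_not_collinear {a b c : ι} (hab : a ≠ b)
    (h : ¬ ∃ l, G.IsLine l ∧ {a, b, c} ⊆ l) : LinearIndependent K ![r a, r b, r c] := by
  have hb : r b ∉ span K {r a} := fun hb => hab (hG.eq_of_mem_span_singleton hb).symm
  refine linearIndependent_triple_iff_notMem.2 ⟨hG.ne_zero a, hb, fun hc => h ?_⟩
  have hline := hG.isLine_closure_pair (linearIndependent_pair_iff_notMem.2 ⟨hG.ne_zero a, hb⟩)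
  rw [← Set.image_pair, ← hG] at hc
  have hsub := G.subset_closure {a, b}
  exact ⟨_, hline, Set.insert_subset (hsub (by simp)) (Set.pair_subset (hsub (by simp)) hc)⟩

theorem planesRedundant (hE : G.EnoughPoints) : PlanesRedundant K r := by
  intro i p q hi
  obtain ⟨Q, hQP, hQ4, hQ⟩ := hE.2 _ (hG.isPlane_closure_triple hi)
  obtain ⟨T, hTQ, hT3⟩ : ∃ T ⊆ Q \ {i}, T.encard = 3 := by
    refine Set.exists_subset_encard_eq ?_
    have hcard := Set.encard_tsub_one_le_encard_sdiff_singleton Q i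
    rwa [hQ4] at hcard
  have hTline := hQ T (hTQ.trans Set.sdiff_subset) hT3
  obtain ⟨a, b, c, hab, -, -, rfl⟩ := Set.encard_eq_three.1 hT3
  have hmem : ∀ j ∈ ({a, b, c} : Set ι), r j ∈ span K {r i, r p, r q} := fun j hj => by
    rw [← Set.image_pair, ← Set.image_insert_eq, ← hG]
    exact hQP (hTQ hj).1
  have hspan : span K (Set.range ![r a, r b, r c]) = span K (Set.range ![r i, r p, r q]) := by
    refine span_range_eq_of_linearIndependent
      (hG.linearIndependent_of_not_collinear hab hTline) fun k => ?_
    rw [range_triple (r i)]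
    fin_cases k
    exacts [hmem a (by simp), hmem b (by simp), hmem c (by simp)]
  refine ⟨{a, b, c}, ?_, fun j hj => ⟨hmem j hj, fun hji => (hTQ hj).2 ?_⟩⟩
  · rw [Set.image_insert_eq, Set.image_pair, ← range_triple, hspan]
    exact subset_span ⟨0, rfl⟩
  · exact hG.eq_of_mem_span_singleton hji

theorem spanMorphism {G' : Geometry κ} {r' : κ → W} (hG' : G'.IsRepresentedBy L r') {φ : ι → κ}
    (hφ : G.IsMorphism G' φ) : SpanMorphism K L r (r' ∘ φ) := fun S i hi => by
  rw [Set.image_comp]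
  exact hG'.1 (isMorphism_apply_mem_closure hφ (hG.2 hi))

theorem rankGT [Nonempty κ] {φ : κ → ι} {n : ℕ}
    (hφ : ∀ (S : Set ι) (m : ℕ), m ≤ n → G.HasDim S m → ¬ Set.range φ ⊆ S) :
    RankGT K (n + 1) (r ∘ φ) := by
  intro s hs
  by_contra! hs'
  obtain ⟨b, hb, hspan, hli⟩ := exists_linearIndependent K (Set.range (r ∘ φ))
  choose w hw using fun x : b => hb x.2
  have hbs : b.encard ≤ n + 1 := by
    refine (encard_le_of_span_le hli ?_).trans (by exact_mod_cast hs)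
    rw [hspan, span_le]
    exact Set.range_subset_iff.2 hs'
  have hb0 : b ≠ ∅ := by
    rintro rfl
    obtain ⟨k⟩ := ‹Nonempty κ›
    have hk : r (φ k) ∈ span K (Set.range (r ∘ φ)) := subset_span ⟨k, rfl⟩
    rw [← hspan, span_empty, mem_bot] at hk
    exact hG.ne_zero _ hk
  obtain ⟨m, hm⟩ : ∃ m : ℕ, b.encard = m + 1 := by
    obtain ⟨l, hl⟩ := ENat.ne_top_iff_exists.1 (hbs.trans_lt (ENat.natCast_lt_top (n + 1))).ne
    obtain ⟨m, rfl⟩ := Nat.exists_eq_succ_of_ne_zero (n := l) fun h0 =>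
      hb0 (Set.encard_eq_zero.1 (by rw [← hl, h0, Nat.cast_zero]))
    exact ⟨m, hl.symm⟩
  have hmn : m ≤ n := by exact_mod_cast (ENat.add_le_add_iff_right ENat.one_ne_top).1 (hm ▸ hbs)
  have hcomp : r ∘ φ ∘ w = ((↑) : b → V) := funext hw
  refine hφ _ m hmn (hG.hasDim_closure_range (w := φ ∘ w) (hcomp ▸ hli) hm) ?_
  refine Set.range_subset_iff.2 fun k => hG.2 ?_
  rw [← Set.range_comp, hcomp, Subtype.range_coe, hspan]
  exact subset_span ⟨k, rfl⟩

end IsRepresentedBy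

end Geometry

end RepresentedGeometries

section PartialProjectiveMorphisms

variable {ι K V L W : Type*} [DivisionRing K] [AddCommGroup V] [Module K V]
  [DivisionRing L] [AddCommGroup W] [Module L W]

theorem span_singleton_rep_mk {v : V} (hv : v ≠ 0) :
    span K {(Projectivization.mk K v hv).rep} = span K {v} := by
  obtain ⟨a, ha⟩ := Projectivization.exists_smul_eq_mk_rep K v hv
  rw [← ha]
  exact span_singleton_group_smul_eq K a v

variable {σ τ : K →+* L} {Φ : V →ₛₗ[σ] W} {Ψ : V →ₛₗ[τ] W}

theorem mem_partialProj_iff {p : ℙ K V} {q : ℙ L W} :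
    q ∈ partialProj Φ p ↔ span L {q.rep} = span L {Φ p.rep} := by
  constructor
  · rintro ⟨h, rfl⟩
    exact span_singleton_rep_mk h
  · intro h
    have h0 : Φ p.rep ≠ 0 := by
      intro h0
      rw [h0, span_zero_singleton, span_singleton_eq_bot] at h
      exact q.rep_nonzero h
    refine ⟨h0, ?_⟩
    exact (Geometry.isRepresentedBy_rep (K := L)).eq_of_mem_span_singleton
      (mem_iff_of_span_eq (span_singleton_rep_mk h0) |>.2 (h ▸ mem_span_singleton_self _))

theorem represents_iff_forall_mem_partialProj {x : ι → ℙ K V} {y : ι → ℙ L W} :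
    Represents Φ (Projectivization.rep ∘ x) (Projectivization.rep ∘ y) ↔
      ∀ i, y i ∈ partialProj Φ (x i) :=
  forall_congr' fun _ => mem_partialProj_iff.symm

theorem partialProj_eq_of_smul {c : L} (hc : c ≠ 0) (h : ∀ v, Ψ v = c • Φ v) :
    partialProj Ψ = partialProj Φ := by
  refine PFun.ext fun p q => ?_
  rw [mem_partialProj_iff, mem_partialProj_iff, h,
    span_singleton_smul_eq (isUnit_iff_ne_zero.2 hc)]

end PartialProjectiveMorphisms

section AffinoProjectiveQuotients

variable {K V : Type*} [DivisionRing K] [AddCommGroup V] [Module K V]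

theorem exists_submodule_of_isAffinoProjective {X : Set (ℙ K V)} {p : ℙ K V}
    (h : ((projGeometry K V).quotient {p}
      ((projGeometry K V).isFlat_singleton p)).IsAffinoProjective
        ((projGeometry K V).quotImage {p} X)) :
    ∃ U : Submodule K V, p.rep ∈ U ∧ U ≠ ⊤ ∧ ∀ q : ℙ K V, q.rep ∉ U →
      ∃ x ∈ X, (projGeometry K V).closure {x, p} = (projGeometry K V).closure {q, p} := by
  obtain ⟨H, ⟨⟨S, hS, hpS, rfl⟩, hne, -⟩, hcov⟩ := h
  have hpull := (projGeometry K V).quotPull_quotImage {p} hS hpS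
  obtain ⟨U, rfl⟩ := hS
  have hp : p.rep ∈ U := (proj_submodule_le_iff p U).1 (hpS rfl)
  refine ⟨U, hp, ?_, fun q hq => ?_⟩
  · rintro rfl
    refine hne (Set.eq_univ_of_forall fun z => ?_)
    obtain ⟨x, rfl⟩ := Quotient.exists_rep z
    exact ⟨x, le_top (a := x.1.submodule), rfl⟩
  · have hqp : q ∉ ({p} : Set (ℙ K V)) := by
      rintro rfl
      exact hq hp
    obtain ⟨x, hxX, hx⟩ | hz :=
      hcov.symm.subset (Set.mem_univ ((projGeometry K V).toQuot _ ⟨q, hqp⟩))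
    · exact ⟨x, hxX, Quotient.exact hx⟩
    · exact absurd ((proj_submodule_le_iff q U).1 (hpull.subset fun _ => hz)) hq

theorem exists_coversComplement {X : Set (ℙ K V)} {p : ℙ K V}
    (h : ((projGeometry K V).quotient {p}
      ((projGeometry K V).isFlat_singleton p)).IsAffinoProjective
        ((projGeometry K V).quotImage {p} X)) :
    ∃ h : V ⧸ span K {p.rep} →ₗ[K] K,
      CoversComplement h ((span K {p.rep}).mkQ ∘ Projectivization.rep ∘ ((↑) : X → ℙ K V)) := by
  obtain ⟨U, hpU, hU, hcov⟩ := exists_submodule_of_isAffinoProjective h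
  have hp : (span K {p.rep}).mkQ p.rep = 0 :=
    (Quotient.mk_eq_zero _).2 (mem_span_singleton_self _)
  have hcomap : (U.map (span K {p.rep}).mkQ).comap (span K {p.rep}).mkQ = U := by
    rw [comap_map_mkQ, sup_eq_right, span_singleton_le_iff_mem]
    exact hpU
  have hmap : U.map (span K {p.rep}).mkQ < ⊤ := by
    refine lt_top_iff_ne_top.2 fun htop => hU ?_
    rw [← hcomap, htop, comap_top]
  obtain ⟨h, h0, hUh⟩ := exists_le_ker_of_lt_top _ hmap
  refine ⟨h, h0, fun v hv => ?_⟩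
  obtain ⟨u, rfl⟩ := mkQ_surjective _ v
  have hu0 : u ≠ 0 := by
    rintro rfl
    exact hv (by rw [map_zero, map_zero])
  have hu : (Projectivization.mk K u hu0).rep ∉ U := fun hu =>
    hv (hUh (mem_map_of_mem ((mem_iff_of_span_eq (span_singleton_rep_mk hu0)).1 hu)))
  obtain ⟨x, hxX, hx⟩ := hcov _ hu
  have hspan := congrArg (Submodule.map (span K {p.rep}).mkQ)
    (Geometry.isRepresentedBy_rep.span_image_eq_of_closure_eq hx)
  simp only [Set.image_pair, span_insert, span_singleton_rep_mk hu0, Submodule.map_sup, map_span,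
    Set.image_singleton, hp, span_zero_singleton, sup_bot_eq] at hspan
  exact ⟨⟨x, hxX⟩, hspan⟩

end AffinoProjectiveQuotients

theorem theorem4 {K V K' V' : Type*} [DivisionRing K] [AddCommGroup V] [Module K V]
    [DivisionRing K'] [AddCommGroup V'] [Module K' V']
    (hK : 4 ≤ ENat.card K ∨ (ENat.card K = 3 ∧ ringChar K' = 3))
    (X : Set (ℙ K V)) (hX : ((projGeometry K V).sub X).EnoughPoints)
    (φ : X → ℙ K' V')
    (hφ : ((projGeometry K V).sub X).IsMorphism (projGeometry K' V') φ)
    (himage : ∀ (S : Set (ℙ K' V')) (r : ℕ), r ≤ 2 → (projGeometry K' V').HasDim S r →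
      ¬ Set.range φ ⊆ S)
    (hloc : ∃ x₁ x₂ : X, φ x₁ ≠ φ x₂ ∧ ∀ x ∈ ({x₁, x₂} : Set X),
      ((projGeometry K V).quotient {x.1}
        ((projGeometry K V).isFlat_singleton x.1)).IsAffinoProjective
          ((projGeometry K V).quotImage {x.1} X)) :
    ∃! f : ℙ K V →. ℙ K' V', IsPartialProjectiveMorphism f ∧ ∀ x : X, φ x ∈ f x.1 := by
  obtain ⟨x₁, x₂, hne, haff⟩ := hloc
  have : Nonempty X := ⟨x₁⟩
  have hK' := fourLeCardOrThreeEqZero_of_card hK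
  obtain ⟨k, hk0, hk1⟩ := hK'.exists_ne_zero_ne_one
  have hG := (Geometry.isRepresentedBy_rep (K := K) (V := V)).sub X
  have hG' := Geometry.isRepresentedBy_rep (K := K') (V := V')
  have hr := hG'.rankGT himage
  have hd := hG'.disjoint_span_singleton hne
  obtain ⟨h₁, hX₁⟩ := exists_coversComplement (haff x₁ (.inl rfl))
  obtain ⟨h₂, hX₂⟩ := exists_coversComplement (haff x₂ (.inr rfl))
  obtain ⟨σ, Φ, hΦ⟩ := (hG.spanMorphism hG' hφ).exists_represents (fun x => (φ x).rep_nonzero)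
    (hG.planesRedundant hX) hX₁ hX₂ hd hr hK'
  refine ⟨partialProj Φ, ⟨⟨σ, Φ, rfl⟩, represents_iff_forall_mem_partialProj.1 hΦ⟩, ?_⟩
  rintro _ ⟨⟨τ, Ψ, rfl⟩, hΨ⟩
  obtain ⟨c, hc⟩ := hΦ.exists_eq_smul (represents_iff_forall_mem_partialProj.2 hΨ)
    (hr.mono (Nat.le_succ 2)) hX₁ hX₂ hd hk0 hk1
  have hc0 : c ≠ 0 := by
    rintro rfl
    obtain ⟨hx, -⟩ := hΨ x₁
    exact hx ((hc _).trans (zero_smul K' _))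
  exact partialProj_eq_of_smul hc0 hc
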